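/- **Setting.** Let $Y\subseteq\mathbb R^{d'}$ be nonempty, closed and convex, and let $f:\mathbb R^d\times Y\to\mathbb R$ have partial gradients $\nabla_xf,\nabla_yf$ on $\mathbb R^d\times Y$. Write $z=(x,y)$, $\|z\|^2=\|x\|^2+\|y\|^2$, $F(z)=(\nabla_xf(z),-\nabla_yf(z))$, $P(x)=\max_{y\in Y}f(x,y)$, and for a function $h$ write $\mathrm{Gap}_h(x,y)=\max_{y'\in Y}h(x,y')-\min_{x'\in\mathbb R^d}h(x',y)$. Assume: 1. $F$ is $\ell$-Lipschitz on $\mathbb R^d\times Y$; $f(x,\cdot)$ is $\mu_y$-strongly concave on $Y$ for every $x$, with $\mu_y>0$; $P$ is $L$-smooth ($L\ge 0$) and has a global minimizer $x_*$; $x_0\in\mathbb R^d$ and $y_0\in Y$ satisfy $\mathrm{Gap}_f(x_0,y_0)\le\epsilon_0$ (in particular $f(\cdot,y_0)$ is bounded below). 2. $\mathcal G_x(x,y;\xi)$ and $\mathcal G_y(x,y;\xi)$, with $\xi\sim D$, are unbiased estimators of $\nabla_xf(x,y)$ and $\nabla_yf(x,y)$ for every $(x,y)\in\mathbb R^d\times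 Y$, each with variance at most $\sigma^2$, where $\sigma>0$. 3. $P$ is $\mu$-PL: $\|\nabla P(x)\|^2\ge 2\mu(P(x)-P(x_*))$ for all $x$, with $\mu>0$; moreover $\mu\le L+2\rho$ (automatic unless $P$ is constant). 4. $f(\cdot,y)$ is $\rho$-weakly convex for every $y\in Y$, i.e. $f(x,y)\ge f(x',y)+\langle\nabla_xf(x',y),x-x'\rangle-\frac\rho2\|x-x'\|^2$, with $0<\rho\le\ell$. **Method.** Put $\gamma=2\rho$. For $k=1,2,\dots$ let $(x_0^k,y_0^k)=(x_{k-1},y_{k-1})$ and $f_k(x,y)=f(x,y)+\frac\gamma2\|x-x_0^k\|^2$, with stochastic operator $\mathcal G_k(z;\xi)=(\mathcal G_x(z;\xi)+\gamma(x-x_0^k),-\mathcal G_y(z;\xi))$. Starting from $\tilde z_0=z_0=(x_0^k,y_0^k)$, stage $k$ runs, for $t=1,\dots,T_k$, $$z_t=\Pi_{\tilde z_{t-1}}(\eta_k\mathcal G_k(z_{t-1};\xi_{t-1})),\qquad \tilde z_t=\Pi_{\tilde z_{t-1}}(\eta_k\mathcal G_k(z_t;\xi_t)),$$ where $\Pi_{\bar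 z}(g)=\arg\min_{z\in\mathbb R^d\times Y}\{\langle g,z\rangle+\frac12\|z-\bar z\|^2\}$, and outputs $(x_k,y_k)=\frac1{T_k}\sum_{t=1}^{T_k}z_t$. All samples, within and across stages, are independent with law $D$. Let $\hat L=L+2\rho$, $c=4\rho+\frac{248}{53}\hat L$, and $$\Delta_k=P(x_0^k)-P(x_*)+\frac{8\hat L}{53c}\,\mathrm{Gap}_{f_k}(x_0^k,y_0^k).$$ For $\eta_0>0$ set $$\eta_k=\eta_0e^{-(k-1)\frac{2\mu}{c+2\mu}},\qquad T_k=\left\lceil\frac{212}{\eta_0\min\{\rho,\mu_y\}}\,e^{(k-1)\frac{2\mu}{c+2\mu}}\right\rceil .$$ **Theorem.** The maxima in $P$ and the minima and maxima in the gaps of the $f_k$ are attained. Let $\epsilon>0$. (a) If $0<\eta_0\le\frac1{2\sqrt2(\ell+2\rho)}$, then for every number of stages $K$ with $$K\ge\max\left\{\frac{c+2\mu}{2\mu}\log\frac{4\epsilon_0}{\epsilon},\ \frac{c+2\mu}{2\mu}\log\frac{208\,\eta_0\hat LK\sigma^2}{(c+2\mu)\epsilon}\right\}$$ $\Delta_{K+1}$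 is integrable and $\mathbb E[\Delta_{K+1}]\le\epsilon$. (b) With $\eta_0=\frac1{2\sqrt2(\ell+2\rho)}$ there is a least $K$ that satisfies the condition in (a), and for it the total number of iterations is $$\sum_{k=1}^KT_k\ \le\ C\,M\log(2+M)=\widetilde O(M),\qquad M=\max\left\{\frac{\ell(L+\rho)\epsilon_0}{\mu\min\{\rho,\mu_y\}\epsilon},\ \frac{(L+\rho)^2\sigma^2}{\mu^2\min\{\rho,\mu_y\}\epsilon}\right\},$$ where $C$ is an absolute constant. -/

import Mathlib

open MeasureTheory ProbabilityTheory

noncomputable section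

/-- The Euclidean space `ℝⁿ`. -/
abbrev Vec (n : ℕ) : Type := EuclideanSpace ℝ (Fin n)

/-- The primal function `P(x) = max_{y ∈ Y} f(x, y)`. -/
def primal {d d' : ℕ} (f : Vec d → Vec d' → ℝ) (Y : Set (Vec d')) (x : Vec d) : ℝ :=
  sSup ((fun y => f x y) '' Y)

/-- The duality gap `max_{y' ∈ Y} h(x, y') - min_{x'} h(x', y)` of `(x, y)` on `h`. -/
def dualityGap {d d' : ℕ} (h : Vec d → Vec d' → ℝ) (Y : Set (Vec d'))
    (x : Vec d) (y : Vec d') : ℝ :=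
  sSup ((fun y' => h x y') '' Y) - sInf (Set.range fun x' => h x' y)

/-- The proximal objective `f(x, y) + (γ / 2) ‖x - x₀‖²`. -/
def proxObj {d d' : ℕ} (f : Vec d → Vec d' → ℝ) (γ : ℝ) (x₀ : Vec d)
    (x : Vec d) (y : Vec d') : ℝ :=
  f x y + γ / 2 * ‖x - x₀‖ ^ 2

/-- The standing assumptions on the problem `min_{x ∈ ℝᵈ} max_{y ∈ Y} f(x, y)`.  The maps `gx` and
`gy` are the partial gradients of `f` on `ℝᵈ × Y` (the gradient in `y` is taken within `Y`). -/
structure NCSCProblem {d d' : ℕ} (f : Vec d → Vec d' → ℝ) (gx : Vec d → Vec d' → Vec d)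
    (gy : Vec d → Vec d' → Vec d') (Y : Set (Vec d')) (l μy L ρ μ : ℝ) (xstar : Vec d) :
    Prop where
  isClosed : IsClosed Y
  convex : Convex ℝ Y
  grad_x : ∀ x, ∀ y ∈ Y, HasGradientAt (fun x' => f x' y) (gx x y) x
  grad_y : ∀ x, ∀ y ∈ Y, HasGradientWithinAt (fun y' => f x y') (gy x y) Y y
  /-- `F = (∇ₓ f, -∇_y f)` is `l`-Lipschitz on `ℝᵈ × Y`. -/
  lipschitz : ∀ x, ∀ y ∈ Y, ∀ x', ∀ y' ∈ Y,
    √(‖gx x y - gx x' y'‖ ^ 2 + ‖gy x y - gy x' y'‖ ^ 2)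
      ≤ l * √(‖x - x'‖ ^ 2 + ‖y - y'‖ ^ 2)
  μy_pos : 0 < μy
  strongConcave : ∀ x, StrongConcaveOn Y μy (fun y => f x y)
  /-- `P` is `L`-smooth. -/
  L_nonneg : 0 ≤ L
  primal_differentiable : Differentiable ℝ (primal f Y)
  primal_smooth : ∀ x x',
    ‖gradient (primal f Y) x - gradient (primal f Y) x'‖ ≤ L * ‖x - x'‖
  /-- `xstar` is a global minimizer of `P`. -/
  xstar_min : ∀ x, primal f Y xstar ≤ primal f Y x
  /-- `f(·, y)` is `ρ`-weakly convex for every `y ∈ Y`. -/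
  ρ_pos : 0 < ρ
  ρ_le : ρ ≤ l
  weakConvex : ∀ y ∈ Y, ∀ x x',
    inner ℝ (gx x' y) (x - x') - ρ / 2 * ‖x - x'‖ ^ 2 ≤ f x y - f x' y
  /-- `P` satisfies the `μ`-PL condition. -/
  μ_pos : 0 < μ
  primal_PL : ∀ x,
    2 * μ * (primal f Y x - primal f Y xstar) ≤ ‖gradient (primal f Y) x‖ ^ 2
  /-- Automatic unless `P` is constant. -/
  μ_le : μ ≤ L + 2 * ρ

/-- `(Gx(x, y; ξ), Gy(x, y; ξ))` with `ξ ∼ D` is an unbiased stochastic gradient of `f` on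
`ℝᵈ × Y`, and both of its parts have variance at most `σ²`. -/
structure StochasticGradient {d d' : ℕ} {Ξ : Type*} [MeasurableSpace Ξ] (D : Measure Ξ)
    (gx : Vec d → Vec d' → Vec d) (gy : Vec d → Vec d' → Vec d') (Y : Set (Vec d'))
    (Gx : Vec d → Vec d' → Ξ → Vec d) (Gy : Vec d → Vec d' → Ξ → Vec d') (σ : ℝ) : Prop where
  σ_pos : 0 < σ
  measurable_x : Measurable fun p : (Vec d × Vec d') × Ξ => Gx p.1.1 p.1.2 p.2
  measurable_y : Measurable fun p : (Vec d × Vec d') × Ξ => Gy p.1.1 p.1.2 p.2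
  integrable_x : ∀ x, ∀ y ∈ Y, Integrable (fun s => Gx x y s) D
  integrable_y : ∀ x, ∀ y ∈ Y, Integrable (fun s => Gy x y s) D
  unbiased_x : ∀ x, ∀ y ∈ Y, ∫ s, Gx x y s ∂D = gx x y
  unbiased_y : ∀ x, ∀ y ∈ Y, ∫ s, Gy x y s ∂D = gy x y
  integrable_sq_x : ∀ x, ∀ y ∈ Y, Integrable (fun s => ‖Gx x y s - gx x y‖ ^ 2) D
  integrable_sq_y : ∀ x, ∀ y ∈ Y, Integrable (fun s => ‖Gy x y s - gy x y‖ ^ 2) D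
  variance_x : ∀ x, ∀ y ∈ Y, ∫ s, ‖Gx x y s - gx x y‖ ^ 2 ∂D ≤ σ ^ 2
  variance_y : ∀ x, ∀ y ∈ Y, ∫ s, ‖Gy x y s - gy x y‖ ^ 2 ∂D ≤ σ ^ 2

/-- The objective `⟪g, z⟫ + ½ ‖z - zbar‖²` of the prox-mapping, where
`‖(x, y)‖² = ‖x‖² + ‖y‖²`. -/
def proxMapObj {d d' : ℕ} (zbar g z : Vec d × Vec d') : ℝ :=
  inner ℝ g.1 z.1 + inner ℝ g.2 z.2 + 1 / 2 * (‖z.1 - zbar.1‖ ^ 2 + ‖z.2 - zbar.2‖ ^ 2)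

open Classical in
/-- The prox-mapping `Π_{zbar}(g) = argmin_{z ∈ ℝᵈ × Y} ⟪g, z⟫ + ½ ‖z - zbar‖²`.  The minimizer
exists and is unique when `Y` is nonempty, closed and convex. -/
def proxMap {d d' : ℕ} (Y : Set (Vec d')) (zbar g : Vec d × Vec d') : Vec d × Vec d' :=
  if h : ∃ z : Vec d × Vec d', z.2 ∈ Y ∧ ∀ w : Vec d × Vec d', w.2 ∈ Y →
      proxMapObj zbar g z ≤ proxMapObj zbar g w
  then h.choose else zbar

/-- The pair `(z_t, z̃_t)` of the OGDA iteration started at `z₀`, where `G z t` is the sampled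
stochastic gradient operator at `z` with the `t`-th sample. -/
def ogda {d d' : ℕ} (Y : Set (Vec d')) (G : Vec d × Vec d' → ℕ → Vec d × Vec d') (η : ℝ)
    (z₀ : Vec d × Vec d') : ℕ → (Vec d × Vec d') × (Vec d × Vec d')
  | 0 => (z₀, z₀)
  | t + 1 =>
    let s := ogda Y G η z₀ t
    let z := proxMap Y s.2 (η • G s.1 t)
    (z, proxMap Y s.2 (η • G z (t + 1)))

/-- The output of one epoch: the average of `z_1, …, z_T`. -/
def ogdaAvg {d d' : ℕ} (Y : Set (Vec d')) (G : Vec d × Vec d' → ℕ → Vec d × Vec d') (η : ℝ)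
    (z₀ : Vec d × Vec d') (T : ℕ) : Vec d × Vec d' :=
  (T : ℝ)⁻¹ • ∑ t ∈ Finset.Icc 1 T, (ogda Y G η z₀ t).1

/-- The stochastic gradient operator `(∇ₓ f(z; s) + γ (x - x₀), -∇_y f(z; s))` of the proximal
objective with centre `x₀`. -/
def stochOp {d d' : ℕ} {Ξ : Type*} (Gx : Vec d → Vec d' → Ξ → Vec d)
    (Gy : Vec d → Vec d' → Ξ → Vec d') (γ : ℝ) (x₀ : Vec d) (z : Vec d × Vec d') (s : Ξ) :
    Vec d × Vec d' :=
  (Gx z.1 z.2 s + γ • (z.1 - x₀), -Gy z.1 z.2 s)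

/-- The proximal epoch stochastic method with OGDA inner solver: the pair `(x_k, y_k)` obtained
after `k` epochs from `z₀ = (x_0, y_0)`.  Epoch `k` has step size `η k`, length `T k` and uses the
samples `ξ k 0, ξ k 1, …`. -/
def pes {d d' : ℕ} {Ξ : Type*} (Y : Set (Vec d')) (Gx : Vec d → Vec d' → Ξ → Vec d)
    (Gy : Vec d → Vec d' → Ξ → Vec d') (γ : ℝ) (η : ℕ → ℝ) (T : ℕ → ℕ) (ξ : ℕ → ℕ → Ξ)
    (z₀ : Vec d × Vec d') : ℕ → Vec d × Vec d'
  | 0 => z₀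
  | k + 1 =>
    let w := pes Y Gx Gy γ η T ξ z₀ k
    ogdaAvg Y (fun z t => stochOp Gx Gy γ w.1 z (ξ (k + 1) t)) (η (k + 1)) w (T (k + 1))

/-- `L̂ = L + 2ρ`. -/
def Lhat (L ρ : ℝ) : ℝ := L + 2 * ρ

/-- `c = 4ρ + (248 / 53) L̂`. -/
def cConst (L ρ : ℝ) : ℝ := 4 * ρ + 248 / 53 * Lhat L ρ

/-- The rate `2μ / (c + 2μ)`. -/
def rate (L ρ μ : ℝ) : ℝ := 2 * μ / (cConst L ρ + 2 * μ)

/-- `η_k = η₀ exp(-(k - 1) 2μ / (c + 2μ))`, for `k ≥ 1`. -/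
def stepSize (L ρ μ η₀ : ℝ) (k : ℕ) : ℝ :=
  η₀ * Real.exp (-(((k : ℝ) - 1) * rate L ρ μ))

/-- `T_k = 212 / (η₀ min{ρ, μ_y}) exp((k - 1) 2μ / (c + 2μ))` for `k ≥ 1`, rounded up. -/
def epochLength (L ρ μ μy η₀ : ℝ) (k : ℕ) : ℕ :=
  ⌈212 / (η₀ * min ρ μy) * Real.exp (((k : ℝ) - 1) * rate L ρ μ)⌉₊

/-- The condition on the number `K` of stages. -/
def EnoughStages (L ρ μ η₀ σ ε₀ ε : ℝ) (K : ℕ) : Prop :=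
  max ((cConst L ρ + 2 * μ) / (2 * μ) * Real.log (4 * ε₀ / ε))
      ((cConst L ρ + 2 * μ) / (2 * μ) *
        Real.log (208 * η₀ * Lhat L ρ * K * σ ^ 2 / ((cConst L ρ + 2 * μ) * ε)))
    ≤ (K : ℝ)

/-- The Lyapunov function `P(x) - P(x_*) + (8 L̂ / (53 c)) Gap(x, y)`, where `Gap` is the duality
gap on the proximal objective with centre `x` and `γ = 2ρ`; at `(x, y) = (x_0^k, y_0^k)` it
is `Δ_k`. -/
def lyapunov {d d' : ℕ} (f : Vec d → Vec d' → ℝ) (Y : Set (Vec d')) (L ρ : ℝ) (xstar : Vec d)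
    (z : Vec d × Vec d') : ℝ :=
  primal f Y z.1 - primal f Y xstar
    + 8 * Lhat L ρ / (53 * cConst L ρ) * dualityGap (proxObj f (2 * ρ) z.1) Y z.1 z.2

/-- The quantity inside the soft-O bound on the total iteration complexity. -/
def complexityBound (l μy L ρ μ σ ε₀ ε : ℝ) : ℝ :=
  max (l * (L + ρ) * ε₀ / (μ * min ρ μy * ε))
    ((L + ρ) ^ 2 * σ ^ 2 / (μ ^ 2 * min ρ μy * ε))

end

/-!
The proof follows one Lyapunov function along the stages.  All estimates are first made along each
sample path, with the noise as an explicit error term, so that no conditional expectations are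
needed: the only probabilistic input is that the noise of a sample is square integrable and
orthogonal to whatever the earlier samples determine.

Inside a stage, the prox-inequalities for `z_t` and `z̃_t` give a regret bound for the optimistic
gradient method that is uniform in the comparison point `u` (`ogda_regret`).  Uniformity matters,
because `u` will be a best response to the random output; it is obtained by comparing `u` with the
auxiliary sequence `z₀ + η ∑ Θ`, which costs a second `½ ‖u - z₀‖²` and leaves inner products of the
noise `Θ` with vectors known beforehand.  Those have mean zero, so the noise in the bound has
expectation at most `7 η σ²` after averaging (`integral_ogdaNoise_le`, `exists_stage_bound`).

Between stages, let `G₀`, `G₁` be the duality gaps of `f_k` at the start and at the output of stage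
`k`.  Taking `u` to be the best responses to the output, strong convexity and strong concavity bound
`‖u - z₀‖²` by a multiple of `G₀ + G₁` (`NCSCProblem.dist_bestResponse_le`), whence
`52 G₁ ≤ G₀ + 53 N` with `N` the noise of the stage.  Smoothness and weak convexity of `P` together
with the PL inequality at the new point give
`(4 ρ + 2 μ) (P(x_k) - P_*) ≤ 4 ρ (P(x_{k-1}) - P_*) + 2 Lhat G₁` (`NCSCProblem.primal_step`), and
`G₁` also controls the gap for the next centre (`NCSCProblem.dualityGap_recenter`).  A combination
of the three is the recursion `(c + 2 μ) Δ_{k+1} ≤ c Δ_k + 8 Lhat N` (`NCSCProblem.lyapunov_step`).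

Since `c / (c + 2 μ) ≤ exp (-rate)` and the step sizes decay at the same rate, the expectation of
`Δ_{K+1}` is at most `exp (-K rate)` times a quantity linear in `K`
(`integral_lyapunov_pes_le`), which the condition on `K` makes smaller than `ε`.  The epoch lengths
form a geometric series, so their sum is governed by `exp ((K - 1) rate)`, and this is bounded
because `K - 1` violates the condition (`sum_epochLength_le_complexityBound`).
-/

noncomputable section

/-! ### Quadratic growth, smoothness and strong concavity -/

section QuadraticGrowth

variable {E : Type*} [NormedAddCommGroup E] [InnerProductSpace ℝ E]

/-- A quadratic lower bound makes `φ` coercive on the closed set `S`. -/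
theorem exists_isMinOn_of_quadratic_lower_bound [ProperSpace E] {S : Set E} (hS : IsClosed S)
    {φ : E → ℝ} (hφ : ContinuousOn φ S) {x₀ g : E} {m : ℝ} (hx₀ : x₀ ∈ S) (hm : 0 < m)
    (h : ∀ x ∈ S, φ x₀ + inner ℝ g (x - x₀) + m / 2 * ‖x - x₀‖ ^ 2 ≤ φ x) :
    ∃ x ∈ S, IsMinOn φ S x := by
  refine hφ.exists_isMinOn' hS hx₀ ?_
  have hK : (Metric.closedBall x₀ (2 * ‖g‖ / m))ᶜ ∈ Filter.cocompact E :=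
    (isCompact_closedBall _ _).compl_mem_cocompact
  filter_upwards [Filter.mem_inf_of_left hK, Filter.mem_inf_of_right (Filter.mem_principal_self S)]
    with x hx hxS
  have hlt : 2 * ‖g‖ / m < ‖x - x₀‖ := by
    simpa [Metric.mem_closedBall, dist_eq_norm] using hx
  rw [div_lt_iff₀ hm] at hlt
  have h1 := h x hxS
  have h2 : -(‖g‖ * ‖x - x₀‖) ≤ inner ℝ g (x - x₀) :=
    neg_le_of_abs_le (abs_real_inner_le_norm g (x - x₀))
  nlinarith [norm_nonneg (x - x₀), norm_nonneg g]

/-- The *descent lemma*. -/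
theorem le_add_inner_add_of_lipschitz_gradient [CompleteSpace E] {φ : E → ℝ} {L : ℝ}
    (hφ : Differentiable ℝ φ)
    (hL : ∀ x y, ‖gradient φ x - gradient φ y‖ ≤ L * ‖x - y‖) (x y : E) :
    φ y ≤ φ x + inner ℝ (gradient φ x) (y - x) + L / 2 * ‖y - x‖ ^ 2 := by
  set v := y - x with hv
  have hder : ∀ t : ℝ, HasDerivAt
      (fun t : ℝ => φ (x + t • v) - t * inner ℝ (gradient φ x) v - L / 2 * ‖v‖ ^ 2 * t ^ 2)
      (inner ℝ (gradient φ (x + t • v)) v - inner ℝ (gradient φ x) v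
        - L / 2 * ‖v‖ ^ 2 * (2 * t)) t := by
    intro t
    have h1 : HasDerivAt (fun t : ℝ => x + t • v) v t := by
      simpa using ((hasDerivAt_id t).smul_const v).const_add x
    have h2 := ((hφ (x + t • v)).hasGradientAt.hasFDerivAt).comp_hasDerivAt t h1
    have h3 : HasDerivAt (fun t : ℝ => t * inner ℝ (gradient φ x) v)
        (inner ℝ (gradient φ x) v) t := by
      simpa using (hasDerivAt_id t).mul_const (inner ℝ (gradient φ x) v)
    have h4 : HasDerivAt (fun t : ℝ => L / 2 * ‖v‖ ^ 2 * t ^ 2)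
        (L / 2 * ‖v‖ ^ 2 * (2 * t)) t := by
      simpa using (hasDerivAt_pow 2 t).const_mul (L / 2 * ‖v‖ ^ 2)
    refine ((h2.sub h3).sub h4).congr_deriv ?_
    simp
  have hanti : AntitoneOn
      (fun t : ℝ => φ (x + t • v) - t * inner ℝ (gradient φ x) v - L / 2 * ‖v‖ ^ 2 * t ^ 2)
      (Set.Ici 0) := by
    refine antitoneOn_of_deriv_nonpos (convex_Ici 0)
      (fun t _ => (hder t).continuousAt.continuousWithinAt)
      (fun t _ => (hder t).differentiableAt.differentiableWithinAt) ?_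
    intro t ht
    rw [interior_Ici, Set.mem_Ioi] at ht
    rw [(hder t).deriv, ← inner_sub_left]
    have h1 := real_inner_le_norm (gradient φ (x + t • v) - gradient φ x) v
    have h2 := hL (x + t • v) x
    rw [add_sub_cancel_left, norm_smul, Real.norm_of_nonneg ht.le] at h2
    nlinarith [norm_nonneg v]
  have h01 := hanti (Set.mem_Ici.2 le_rfl) (Set.mem_Ici.2 zero_le_one) zero_le_one
  have hxy : x + v = y := by simp [hv]
  simp only [one_smul, zero_smul, add_zero, hxy] at h01
  linarith

/-- Quadratic decay away from a maximizer, also when the maximizer is on the boundary of `S`. -/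
theorem StrongConcaveOn.le_sub_of_isMaxOn {S : Set E} {φ : E → ℝ} {m : ℝ}
    (h : StrongConcaveOn S m φ) {x y : E} (hx : x ∈ S) (hmax : IsMaxOn φ S x) (hy : y ∈ S) :
    φ y + m / 2 * ‖y - x‖ ^ 2 ≤ φ x := by
  have key : ∀ t ∈ Set.Ioo (0 : ℝ) 1, φ y + (1 - t) * (m / 2 * ‖y - x‖ ^ 2) ≤ φ x := by
    intro t ht
    have h1 := h.2 hy hx ht.1.le (sub_nonneg.2 ht.2.le) (by ring)
    have h2 : φ (t • y + (1 - t) • x) ≤ φ x :=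
      hmax (h.1 hy hx ht.1.le (sub_nonneg.2 ht.2.le) (by ring))
    simp only [smul_eq_mul] at h1
    have h3 : t * (φ y + (1 - t) * (m / 2 * ‖y - x‖ ^ 2)) ≤ t * φ x := by
      nlinarith
    exact le_of_mul_le_mul_left h3 ht.1
  have hlim : Filter.Tendsto (fun t : ℝ => φ y + (1 - t) * (m / 2 * ‖y - x‖ ^ 2))
      (nhdsWithin 0 (Set.Ioi 0)) (nhds (φ y + (1 - 0) * (m / 2 * ‖y - x‖ ^ 2))) :=
    ((by fun_prop : Continuous fun t : ℝ =>
      φ y + (1 - t) * (m / 2 * ‖y - x‖ ^ 2)).tendsto 0).mono_left nhdsWithin_le_nhds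
  have := le_of_tendsto hlim (by
    filter_upwards [Ioo_mem_nhdsGT (zero_lt_one' ℝ)] with t ht using key t ht)
  linarith

/-- The first-order upper bound for a strongly concave function, with a gradient within `S` only:
it follows from the one-sided slopes along the segment from `x` to `y`. -/
theorem StrongConcaveOn.le_add_inner_sub [CompleteSpace E] {S : Set E} {φ : E → ℝ} {m : ℝ}
    (h : StrongConcaveOn S m φ) {x y g : E} (hx : x ∈ S) (hg : HasGradientWithinAt φ g S x)
    (hy : y ∈ S) :
    φ y ≤ φ x + inner ℝ g (y - x) - m / 2 * ‖y - x‖ ^ 2 := by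
  have hline : HasDerivWithinAt (fun t : ℝ => φ (x + t • (y - x))) (inner ℝ g (y - x))
      (Set.Icc 0 1) 0 := by
    have h1 : HasDerivWithinAt (fun t : ℝ => x + t • (y - x)) (y - x) (Set.Icc 0 1) 0 := by
      simpa using (((hasDerivAt_id (0 : ℝ)).smul_const (y - x)).const_add x).hasDerivWithinAt
    have hg' : HasFDerivWithinAt φ (InnerProductSpace.toDual ℝ E g) S
        (x + (0 : ℝ) • (y - x)) := by
      simpa using hg.hasFDerivWithinAt
    have := hg'.comp_hasDerivWithinAt (0 : ℝ) h1
      (fun t ht => h.1.add_smul_sub_mem hx hy ht)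
    refine this.congr_deriv ?_
    simp
  have hslope := hasDerivWithinAt_iff_tendsto_slope.1 hline
  have hle : ∀ᶠ t in nhdsWithin (0 : ℝ) (Set.Icc 0 1 \ {0}),
      φ y - φ x + (1 - t) * (m / 2 * ‖y - x‖ ^ 2)
        ≤ slope (fun t : ℝ => φ (x + t • (y - x))) 0 t := by
    filter_upwards [self_mem_nhdsWithin] with t ht
    have ht0 : 0 < t := lt_of_le_of_ne ht.1.1 (Ne.symm ht.2)
    have h1 := h.2 hy hx ht0.le (sub_nonneg.2 ht.1.2) (by ring)
    simp only [smul_eq_mul] at h1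
    have hpt : t • y + (1 - t) • x = x + t • (y - x) := by
      rw [smul_sub, sub_smul, one_smul]; abel
    rw [hpt] at h1
    rw [slope_def_field, le_div_iff₀ (by simpa using ht0)]
    simp only [zero_smul, add_zero, sub_zero]
    nlinarith
  have hne : (nhdsWithin (0 : ℝ) (Set.Icc 0 1 \ {0})).NeBot := by
    have : Set.Icc (0 : ℝ) 1 \ {0} = Set.Ioc 0 1 := by
      ext t; simp only [Set.mem_sdiff, Set.mem_Icc, Set.mem_singleton_iff, Set.mem_Ioc]
      constructor
      · rintro ⟨⟨h0, h1⟩, h2⟩; exact ⟨lt_of_le_of_ne h0 (Ne.symm h2), h1⟩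
      · rintro ⟨h0, h1⟩; exact ⟨⟨h0.le, h1⟩, h0.ne'⟩
    rw [this, nhdsWithin_Ioc_eq_nhdsGT zero_lt_one]
    infer_instance
  have hlim : Filter.Tendsto (fun t : ℝ => φ y - φ x + (1 - t) * (m / 2 * ‖y - x‖ ^ 2))
      (nhdsWithin 0 (Set.Icc 0 1 \ {0}))
      (nhds (φ y - φ x + (1 - 0) * (m / 2 * ‖y - x‖ ^ 2))) :=
    ((by fun_prop : Continuous fun t : ℝ =>
      φ y - φ x + (1 - t) * (m / 2 * ‖y - x‖ ^ 2)).tendsto 0).mono_left nhdsWithin_le_nhds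
  have := le_of_tendsto_of_tendsto hlim hslope hle
  linarith

end QuadraticGrowth

/-! ### The deterministic recursion for the Lyapunov function -/

/-- The value `min_x f(x, y) + ρ ‖x - w‖²` of the proximal objective with centre `w`, as a function
of the centre and of `y`. -/
def proxEnvelope {d d' : ℕ} (f : Vec d → Vec d' → ℝ) (ρ : ℝ) (w : Vec d) (y : Vec d') : ℝ :=
  sInf (Set.range fun x => proxObj f (2 * ρ) w x y)

namespace NCSCProblem

variable {d d' : ℕ} {f : Vec d → Vec d' → ℝ} {gx : Vec d → Vec d' → Vec d}
  {gy : Vec d → Vec d' → Vec d'} {Y : Set (Vec d')} {l μy L ρ μ : ℝ} {xstar : Vec d}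

theorem le_add_inner_sub_snd (hp : NCSCProblem f gx gy Y l μy L ρ μ xstar) (x : Vec d)
    {y y' : Vec d'} (hy : y ∈ Y) (hy' : y' ∈ Y) :
    f x y' ≤ f x y + inner ℝ (gy x y) (y' - y) - μy / 2 * ‖y' - y‖ ^ 2 :=
  (hp.strongConcave x).le_add_inner_sub hy (hp.grad_y x y hy) hy'

/-- The term `ρ ‖x - w‖²` turns `ρ`-weak convexity into `ρ`-strong convexity. -/
theorem proxObj_add_inner_le (hp : NCSCProblem f gx gy Y l μy L ρ μ xstar) (w x x' : Vec d)
    {y : Vec d'} (hy : y ∈ Y) :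
    proxObj f (2 * ρ) w x y + inner ℝ (gx x y + (2 * ρ) • (x - w)) (x' - x)
      + ρ / 2 * ‖x' - x‖ ^ 2 ≤ proxObj f (2 * ρ) w x' y := by
  have h := hp.weakConvex y hy x' x
  have h2 : ‖x' - w‖ ^ 2 = ‖x' - x‖ ^ 2 + 2 * inner ℝ (x - w) (x' - x) + ‖x - w‖ ^ 2 := by
    rw [← sub_add_sub_cancel x' x w, norm_add_sq_real, real_inner_comm]
  simp only [proxObj, inner_add_left, inner_smul_left, h2]
  simp only [conj_trivial]
  linarith

theorem continuous_fst (hp : NCSCProblem f gx gy Y l μy L ρ μ xstar) {y : Vec d'} (hy : y ∈ Y) :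
    Continuous fun x => f x y :=
  continuous_iff_continuousAt.2 fun x => (hp.grad_x x y hy).differentiableAt.continuousAt

theorem continuousOn_snd (hp : NCSCProblem f gx gy Y l μy L ρ μ xstar) (x : Vec d) :
    ContinuousOn (fun y => f x y) Y :=
  fun y hy => (hp.grad_y x y hy).differentiableWithinAt.continuousWithinAt

theorem continuous_proxObj_fst (hp : NCSCProblem f gx gy Y l μy L ρ μ xstar) (w : Vec d)
    {y : Vec d'} (hy : y ∈ Y) : Continuous fun x => proxObj f (2 * ρ) w x y := by
  have := hp.continuous_fst hy
  unfold proxObj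
  fun_prop

theorem exists_isMaxOn (hp : NCSCProblem f gx gy Y l μy L ρ μ xstar) (hY : Y.Nonempty)
    (x : Vec d) : ∃ y ∈ Y, IsMaxOn (fun y => f x y) Y y := by
  obtain ⟨y₀, hy₀⟩ := hY
  obtain ⟨y, hy, hmin⟩ := exists_isMinOn_of_quadratic_lower_bound hp.isClosed
    (hp.continuousOn_snd x).neg (g := -gy x y₀) hy₀ hp.μy_pos (fun y hy => by
      have := hp.le_add_inner_sub_snd x hy₀ hy
      rw [inner_neg_left, Pi.neg_apply, Pi.neg_apply]
      linarith)
  exact ⟨y, hy, fun y' hy' => neg_le_neg_iff.1 (isMinOn_iff.1 hmin y' hy')⟩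

theorem exists_isMinOn (hp : NCSCProblem f gx gy Y l μy L ρ μ xstar) (w : Vec d)
    {y : Vec d'} (hy : y ∈ Y) :
    ∃ x, IsMinOn (fun x => proxObj f (2 * ρ) w x y) Set.univ x := by
  obtain ⟨x, -, hmin⟩ := exists_isMinOn_of_quadratic_lower_bound isClosed_univ
    (hp.continuous_proxObj_fst w hy).continuousOn (Set.mem_univ w) hp.ρ_pos
    (fun x _ => hp.proxObj_add_inner_le w w x hy)
  exact ⟨x, hmin⟩

theorem exists_primal_eq (hp : NCSCProblem f gx gy Y l μy L ρ μ xstar) (hY : Y.Nonempty)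
    (x : Vec d) :
    ∃ y ∈ Y, primal f Y x = f x y ∧ ∀ y' ∈ Y, f x y' + μy / 2 * ‖y' - y‖ ^ 2 ≤ f x y := by
  obtain ⟨y, hy, hmax⟩ := hp.exists_isMaxOn hY x
  refine ⟨y, hy, IsGreatest.csSup_eq ⟨⟨y, hy, rfl⟩, ?_⟩, fun y' hy' =>
    (hp.strongConcave x).le_sub_of_isMaxOn hy hmax hy'⟩
  rintro _ ⟨y', hy', rfl⟩
  exact hmax hy'

theorem le_primal (hp : NCSCProblem f gx gy Y l μy L ρ μ xstar) (x : Vec d) {y : Vec d'}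
    (hy : y ∈ Y) : f x y ≤ primal f Y x := by
  obtain ⟨y', hy', h, hmax⟩ := hp.exists_primal_eq ⟨y, hy⟩ x
  have := hmax y hy
  have := hp.μy_pos
  rw [h]
  nlinarith [sq_nonneg ‖y - y'‖]

theorem exists_proxEnvelope_eq (hp : NCSCProblem f gx gy Y l μy L ρ μ xstar) (w : Vec d)
    {y : Vec d'} (hy : y ∈ Y) :
    ∃ x, proxEnvelope f ρ w y = proxObj f (2 * ρ) w x y ∧
      ∀ x', proxObj f (2 * ρ) w x y + ρ / 2 * ‖x' - x‖ ^ 2 ≤ proxObj f (2 * ρ) w x' y := by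
  obtain ⟨x, hmin⟩ := hp.exists_isMinOn w hy
  refine ⟨x, IsLeast.csInf_eq ⟨⟨x, rfl⟩, ?_⟩, fun x' => ?_⟩
  · rintro _ ⟨x', rfl⟩
    exact hmin (Set.mem_univ x')
  · -- The gradient of the proximal objective vanishes at `x`: otherwise a short step against it
    -- would contradict the minimality of `x`.
    have hgrad : gx x y + (2 * ρ) • (x - w) = 0 := by
      have h1 : HasFDerivAt (fun x => proxObj f (2 * ρ) w x y)
          (InnerProductSpace.toDual ℝ _ (gx x y + (2 * ρ) • (x - w))) x := by
        have h2 := (((hasStrictFDerivAt_norm_sq (x - w)).hasFDerivAt).comp x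
          ((hasFDerivAt_id x).sub_const w)).const_mul (2 * ρ / 2)
        refine ((hp.grad_x x y hy).hasFDerivAt.add h2).congr_fderiv ?_
        ext v
        simp
        ring
      have := (hmin.isLocalMin Filter.univ_mem).hasFDerivAt_eq_zero h1
      rwa [LinearIsometryEquiv.map_eq_zero_iff] at this
    have := hp.proxObj_add_inner_le w x x' hy
    rw [hgrad, inner_zero_left] at this
    linarith

theorem proxEnvelope_le (hp : NCSCProblem f gx gy Y l μy L ρ μ xstar) (w x : Vec d)
    {y : Vec d'} (hy : y ∈ Y) : proxEnvelope f ρ w y ≤ proxObj f (2 * ρ) w x y := by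
  obtain ⟨x', h, hmin⟩ := hp.exists_proxEnvelope_eq w hy
  have := hmin x
  have := hp.ρ_pos
  rw [h]
  nlinarith [sq_nonneg ‖x - x'‖]

theorem dualityGap_proxObj (hp : NCSCProblem f gx gy Y l μy L ρ μ xstar) (w x : Vec d)
    {y : Vec d'} (hy : y ∈ Y) :
    dualityGap (proxObj f (2 * ρ) w) Y x y
      = primal f Y x + ρ * ‖x - w‖ ^ 2 - proxEnvelope f ρ w y := by
  obtain ⟨y', hy', h, hmax⟩ := hp.exists_primal_eq ⟨y, hy⟩ x
  have : sSup ((fun y' => proxObj f (2 * ρ) w x y') '' Y) = primal f Y x + ρ * ‖x - w‖ ^ 2 := by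
    refine IsGreatest.csSup_eq ⟨⟨y', hy', ?_⟩, ?_⟩
    · simp only [proxObj, h]; ring
    · rintro _ ⟨y'', hy'', rfl⟩
      have := hp.le_primal x hy''
      simp only [proxObj]
      linarith
  rw [dualityGap, this, proxEnvelope]

theorem dualityGap_nonneg (hp : NCSCProblem f gx gy Y l μy L ρ μ xstar) (w x : Vec d)
    {y : Vec d'} (hy : y ∈ Y) : 0 ≤ dualityGap (proxObj f (2 * ρ) w) Y x y := by
  rw [hp.dualityGap_proxObj w x hy]
  have h1 := hp.proxEnvelope_le w x hy
  have h2 := hp.le_primal x hy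
  simp only [proxObj] at h1
  linarith

/-- Strong convexity and strong concavity bound the distance of `(x₀, y₀)` to the best responses to
`(x₁, y₁)` by the two duality gaps. -/
theorem dist_bestResponse_le (hp : NCSCProblem f gx gy Y l μy L ρ μ xstar) (w x₀ x₁ x : Vec d)
    {y₀ y₁ y : Vec d'} (hy₀ : y₀ ∈ Y) (hy₁ : y₁ ∈ Y)
    (hxe : proxEnvelope f ρ w y₁ = proxObj f (2 * ρ) w x y₁)
    (hx : ∀ x', proxObj f (2 * ρ) w x y₁ + ρ / 2 * ‖x' - x‖ ^ 2 ≤ proxObj f (2 * ρ) w x' y₁)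
    (hye : primal f Y x₁ = f x₁ y)
    (hy : ∀ y' ∈ Y, f x₁ y' + μy / 2 * ‖y' - y‖ ^ 2 ≤ f x₁ y) :
    min ρ μy / 2 * (‖x - x₀‖ ^ 2 + ‖y - y₀‖ ^ 2)
      ≤ dualityGap (proxObj f (2 * ρ) w) Y x₀ y₀ + dualityGap (proxObj f (2 * ρ) w) Y x₁ y₁ := by
  rw [hp.dualityGap_proxObj w x₀ hy₀, hp.dualityGap_proxObj w x₁ hy₁]
  have h1 := hx x₀
  have h2 := hy y₀ hy₀
  have h3 := hp.le_primal x₀ hy₁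
  have h4 := hp.proxEnvelope_le w x₁ hy₀
  rw [norm_sub_rev x x₀, norm_sub_rev y y₀]
  have h5 : min ρ μy / 2 * (‖x₀ - x‖ ^ 2 + ‖y₀ - y‖ ^ 2)
      ≤ ρ / 2 * ‖x₀ - x‖ ^ 2 + μy / 2 * ‖y₀ - y‖ ^ 2 := by
    nlinarith [min_le_left ρ μy, min_le_right ρ μy, sq_nonneg ‖x₀ - x‖, sq_nonneg ‖y₀ - y‖]
  simp only [proxObj] at *
  linarith

/-- Moving the centre of the proximal term to the new point: the duality gap for the old centre
controls the one for the new centre and the change of the primal value. -/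
theorem dualityGap_recenter (hp : NCSCProblem f gx gy Y l μy L ρ μ xstar) (a b : Vec d)
    {y : Vec d'} (hy : y ∈ Y) :
    3 / 50 * dualityGap (proxObj f (2 * ρ) b) Y b y + 4 / 5 * (primal f Y b - primal f Y a)
      ≤ dualityGap (proxObj f (2 * ρ) a) Y b y := by
  have hnn := hp.dualityGap_nonneg b b hy
  rw [hp.dualityGap_proxObj b b hy] at hnn ⊢
  rw [hp.dualityGap_proxObj a b hy]
  obtain ⟨x, hx, hmin⟩ := hp.exists_proxEnvelope_eq b hy
  have h1 := hmin b
  have h2 := hp.proxEnvelope_le a x hy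
  have h3 := hp.proxEnvelope_le a a hy
  have h4 := hp.le_primal b hy
  have h5 := hp.le_primal a hy
  -- Young's inequality with weight `1 / 4`
  have h6 : ‖x - a‖ ^ 2 ≤ 5 / 4 * ‖b - x‖ ^ 2 + 5 * ‖b - a‖ ^ 2 := by
    have h7 := norm_sub_le (b - a) (b - x)
    rw [show b - a - (b - x) = x - a by abel] at h7
    nlinarith [sq_nonneg (‖b - x‖ - 4 * ‖b - a‖), norm_nonneg (x - a)]
  have hρ := hp.ρ_pos
  have h7 := mul_le_mul_of_nonneg_left h6 hρ.le
  simp only [proxObj, sub_self, norm_zero, norm_sub_rev x b] at *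
  linarith

/-- The primal function inherits weak convexity, because its gradient at `b` is the partial gradient
of `f` at `b` and at the best response to `b`. -/
theorem primal_weakConvex (hp : NCSCProblem f gx gy Y l μy L ρ μ xstar) (hY : Y.Nonempty)
    (a b : Vec d) :
    primal f Y b + inner ℝ (gradient (primal f Y) b) (a - b) - ρ / 2 * ‖a - b‖ ^ 2
      ≤ primal f Y a := by
  obtain ⟨y, hy, hye, -⟩ := hp.exists_primal_eq hY b
  have hgrad : gradient (primal f Y) b = gx b y := by
    have h1 := (hp.primal_differentiable b).hasGradientAt.hasFDerivAt.sub
      (hp.grad_x b y hy).hasFDerivAt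
    have hmin : IsLocalMin (primal f Y - fun x => f x y) b :=
      Filter.Eventually.of_forall fun x => by
        have := hp.le_primal x hy
        simp only [Pi.sub_apply, hye]
        linarith
    have h2 := hmin.hasFDerivAt_eq_zero h1
    rw [← map_sub, LinearIsometryEquiv.map_eq_zero_iff, sub_eq_zero] at h2
    exact h2
  have h1 := hp.weakConvex y hy a b
  have h2 := hp.le_primal a hy
  rw [hgrad, hye]
  linarith

theorem Lhat_pos (hp : NCSCProblem f gx gy Y l μy L ρ μ xstar) : 0 < Lhat L ρ := by
  have := hp.ρ_pos
  have := hp.L_nonneg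
  unfold Lhat
  linarith

/-- The gradient of `P + ρ ‖· - a‖²` at `b` is controlled by the duality gap, because
`P + ρ ‖· - a‖²` is smooth and bounded below by the minimum over `x` of the proximal objective. -/
theorem norm_gradient_primal_add_le (hp : NCSCProblem f gx gy Y l μy L ρ μ xstar)
    (a b : Vec d) {y : Vec d'} (hy : y ∈ Y) :
    ‖gradient (primal f Y) b + (2 * ρ) • (b - a)‖ ^ 2
      ≤ 2 * Lhat L ρ * dualityGap (proxObj f (2 * ρ) a) Y b y := by
  rw [hp.dualityGap_proxObj a b hy]
  have hL := hp.Lhat_pos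
  set g := gradient (primal f Y) b + (2 * ρ) • (b - a) with hg
  -- one gradient step from `b` on the `Lhat`-smooth function `P + ρ ‖· - a‖²`
  set x := b - (Lhat L ρ)⁻¹ • g with hx
  have hxb : x - b = -((Lhat L ρ)⁻¹ • g) := by rw [hx]; abel
  have h1 := le_add_inner_add_of_lipschitz_gradient hp.primal_differentiable hp.primal_smooth b x
  have h2 := hp.proxEnvelope_le a x hy
  have h3 := hp.le_primal x hy
  have h4 : ‖x - a‖ ^ 2 = ‖x - b‖ ^ 2 + 2 * inner ℝ (b - a) (x - b) + ‖b - a‖ ^ 2 := by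
    rw [← sub_add_sub_cancel x b a, norm_add_sq_real, real_inner_comm]
  have h5 : inner ℝ g (x - b) = inner ℝ (gradient (primal f Y) b) (x - b)
      + 2 * ρ * inner ℝ (b - a) (x - b) := by
    rw [hg, inner_add_left, inner_smul_left, conj_trivial]
  have h6 : inner ℝ g (x - b) = -((Lhat L ρ)⁻¹ * ‖g‖ ^ 2) := by
    rw [hxb, inner_neg_right, inner_smul_right, real_inner_self_eq_norm_sq]
  have h7 : ‖x - b‖ ^ 2 = (Lhat L ρ)⁻¹ ^ 2 * ‖g‖ ^ 2 := by
    rw [hxb, norm_neg, norm_smul, mul_pow, Real.norm_of_nonneg (inv_nonneg.2 hL.le)]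
  have h8 : Lhat L ρ / 2 * ‖x - b‖ ^ 2 = (Lhat L ρ)⁻¹ * ‖g‖ ^ 2 / 2 := by
    rw [h7]; field_simp
  have h9 : Lhat L ρ / 2 * ‖x - b‖ ^ 2 = L / 2 * ‖x - b‖ ^ 2 + ρ * ‖x - b‖ ^ 2 := by
    unfold Lhat; ring
  have h10 : (Lhat L ρ)⁻¹ * ‖g‖ ^ 2 / 2
      ≤ primal f Y b + ρ * ‖b - a‖ ^ 2 - proxEnvelope f ρ a y := by
    simp only [proxObj] at h2
    rw [h4] at h2
    linarith
  calc ‖g‖ ^ 2 = 2 * Lhat L ρ * ((Lhat L ρ)⁻¹ * ‖g‖ ^ 2 / 2) := by field_simp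
    _ ≤ _ := by gcongr

/-- One proximal step: the PL inequality at the new point, with an error governed by the duality
gap of the proximal problem. -/
theorem primal_step (hp : NCSCProblem f gx gy Y l μy L ρ μ xstar) (a b : Vec d)
    {y : Vec d'} (hy : y ∈ Y) :
    (4 * ρ + 2 * μ) * (primal f Y b - primal f Y xstar)
      ≤ 4 * ρ * (primal f Y a - primal f Y xstar)
        + 2 * Lhat L ρ * dualityGap (proxObj f (2 * ρ) a) Y b y := by
  have h1 := hp.primal_weakConvex ⟨y, hy⟩ a b
  have h2 := hp.norm_gradient_primal_add_le a b hy
  have h3 := hp.primal_PL b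
  have hρ := hp.ρ_pos
  rw [norm_add_sq_real, inner_smul_right, norm_smul, Real.norm_of_nonneg (by linarith)] at h2
  rw [← neg_sub b a, inner_neg_right, norm_neg] at h1
  nlinarith [mul_le_mul_of_nonneg_left h1 (by linarith : 0 ≤ 4 * ρ), mul_nonneg hρ.le hρ.le,
    mul_nonneg (mul_nonneg hρ.le hρ.le) (sq_nonneg ‖b - a‖)]

/-- The recursion for the Lyapunov function over one stage.  Here `A` is `ηT` and `N` the averaged
noise of the stage. -/
theorem lyapunov_step (hp : NCSCProblem f gx gy Y l μy L ρ μ xstar) {z₀ z₁ : Vec d × Vec d'}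
    (h₀ : z₀.2 ∈ Y) (h₁ : z₁.2 ∈ Y) {A N : ℝ} (hA : 212 / min ρ μy ≤ A)
    (h : ∀ x, ∀ y ∈ Y, proxObj f (2 * ρ) z₀.1 z₁.1 y - proxObj f (2 * ρ) z₀.1 x z₁.2
      ≤ (‖x - z₀.1‖ ^ 2 + ‖y - z₀.2‖ ^ 2) / A + N) :
    (cConst L ρ + 2 * μ) * lyapunov f Y L ρ xstar z₁
      ≤ cConst L ρ * lyapunov f Y L ρ xstar z₀ + 8 * Lhat L ρ * N := by
  obtain ⟨x, hxe, hx⟩ := hp.exists_proxEnvelope_eq z₀.1 h₁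
  obtain ⟨y, hy, hye, hymax⟩ := hp.exists_primal_eq ⟨_, h₁⟩ z₁.1
  have hdist := hp.dist_bestResponse_le z₀.1 z₀.1 z₁.1 x h₀ h₁ hxe hx hye hymax
  have hrec := hp.dualityGap_recenter z₀.1 z₁.1 h₁
  have hstep := hp.primal_step z₀.1 z₁.1 h₁
  have hG0 := hp.dualityGap_nonneg z₀.1 z₀.1 h₀
  have hG1 := hp.dualityGap_nonneg z₀.1 z₁.1 h₁
  have hG2 := hp.dualityGap_nonneg z₁.1 z₁.1 h₁
  have hgap : dualityGap (proxObj f (2 * ρ) z₀.1) Y z₁.1 z₁.2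
      = proxObj f (2 * ρ) z₀.1 z₁.1 y - proxObj f (2 * ρ) z₀.1 x z₁.2 := by
    rw [hp.dualityGap_proxObj _ _ h₁, hxe, hye]; simp only [proxObj]; ring
  have hxy := h x y hy
  rw [← hgap] at hxy
  simp only [lyapunov]
  set G₀ := dualityGap (proxObj f (2 * ρ) z₀.1) Y z₀.1 z₀.2
  set G₁ := dualityGap (proxObj f (2 * ρ) z₀.1) Y z₁.1 z₁.2
  set G₂ := dualityGap (proxObj f (2 * ρ) z₁.1) Y z₁.1 z₁.2
  have hm : 0 < min ρ μy := lt_min hp.ρ_pos hp.μy_pos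
  have hD : (‖x - z₀.1‖ ^ 2 + ‖y - z₀.2‖ ^ 2) / A ≤ (G₀ + G₁) / 53 := by
    have hA0 : 0 < A := lt_of_lt_of_le (by positivity) hA
    rw [div_le_iff₀ hm] at hA
    rw [div_le_div_iff₀ hA0 (by norm_num)]
    nlinarith
  have hmain : 52 * G₁ ≤ G₀ + 53 * N := by linarith
  have hL := hp.Lhat_pos
  have hρ := hp.ρ_pos
  have hc : 0 < cConst L ρ := by unfold cConst; linarith
  have hμ : 2 * μ ≤ 53 / 124 * cConst L ρ := by
    have := hp.μ_le
    unfold cConst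
    change μ ≤ Lhat L ρ at this
    linarith
  -- `310 / 53` copies of the recentring inequality split `2 Lhat G₁` so that the coefficients of
  -- `P(x) - P(x_*)` become `c + 2 μ` and `c`
  have hLG : Lhat L ρ * (52 * G₁) ≤ Lhat L ρ * (G₀ + 53 * N) :=
    mul_le_mul_of_nonneg_left hmain hL.le
  have hLrec := mul_le_mul_of_nonneg_left hrec hL.le
  have hcoef : (cConst L ρ + 2 * μ) * (8 * Lhat L ρ / (53 * cConst L ρ) * G₂)
      ≤ Lhat L ρ * (310 / 53 * (3 / 50 * G₂)) := by
    have : (cConst L ρ + 2 * μ) * (8 * Lhat L ρ / (53 * cConst L ρ) * G₂)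
        = (Lhat L ρ * G₂) * ((cConst L ρ + 2 * μ) / cConst L ρ * (8 / 53)) := by
      field_simp
    rw [this, show Lhat L ρ * (310 / 53 * (3 / 50 * G₂))
      = (Lhat L ρ * G₂) * (310 / 53 * (3 / 50)) by ring]
    refine mul_le_mul_of_nonneg_left ?_ (by positivity)
    have : (cConst L ρ + 2 * μ) / cConst L ρ ≤ 177 / 124 := by
      rw [div_le_iff₀ hc]; linarith
    linarith
  have hcoef0 : cConst L ρ * (8 * Lhat L ρ / (53 * cConst L ρ) * G₀) = 8 / 53 * (Lhat L ρ * G₀) := by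
    field_simp
  rw [mul_add, mul_add, hcoef0]
  have hcdef : cConst L ρ = 4 * ρ + 248 / 53 * Lhat L ρ := rfl
  rw [hcdef] at hcoef ⊢
  linarith

theorem dualityGap_proxObj_le (hp : NCSCProblem f gx gy Y l μy L ρ μ xstar) (x : Vec d)
    {y : Vec d'} (hy : y ∈ Y) (hb : BddBelow (Set.range fun x => f x y)) :
    dualityGap (proxObj f (2 * ρ) x) Y x y ≤ dualityGap f Y x y := by
  obtain ⟨x', hx', -⟩ := hp.exists_proxEnvelope_eq x hy
  have h1 : sInf (Set.range fun x => f x y) ≤ f x' y := csInf_le hb ⟨x', rfl⟩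
  rw [hp.dualityGap_proxObj x x hy, hx']
  simp only [dualityGap, proxObj, primal, sub_self, norm_zero]
  have := mul_nonneg hp.ρ_pos.le (sq_nonneg ‖x' - x‖)
  linarith

theorem primal_sub_le_dualityGap (hp : NCSCProblem f gx gy Y l μy L ρ μ xstar) (x : Vec d)
    {y : Vec d'} (hy : y ∈ Y) (hb : BddBelow (Set.range fun x => f x y)) :
    primal f Y x - primal f Y xstar ≤ dualityGap f Y x y := by
  have h1 : sInf (Set.range fun x => f x y) ≤ f xstar y := csInf_le hb ⟨xstar, rfl⟩
  have h2 := hp.le_primal xstar hy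
  simp only [dualityGap, ← primal.eq_1]
  linarith

theorem lyapunov_nonneg (hp : NCSCProblem f gx gy Y l μy L ρ μ xstar) {z : Vec d × Vec d'}
    (hz : z.2 ∈ Y) : 0 ≤ lyapunov f Y L ρ xstar z := by
  have h1 := hp.dualityGap_nonneg z.1 z.1 hz
  have h2 := hp.xstar_min z.1
  have hL := hp.Lhat_pos
  have hρ := hp.ρ_pos
  have hc : 0 < cConst L ρ := by unfold cConst; linarith
  unfold lyapunov
  have : 0 ≤ 8 * Lhat L ρ / (53 * cConst L ρ) * dualityGap (proxObj f (2 * ρ) z.1) Y z.1 z.2 := by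
    positivity
  linarith

theorem lyapunov_le (hp : NCSCProblem f gx gy Y l μy L ρ μ xstar) {z : Vec d × Vec d'}
    (hz : z.2 ∈ Y) (hb : BddBelow (Set.range fun x => f x z.2)) :
    lyapunov f Y L ρ xstar z ≤ 32 / 31 * dualityGap f Y z.1 z.2 := by
  have h1 := hp.dualityGap_nonneg z.1 z.1 hz
  have h2 := hp.dualityGap_proxObj_le z.1 hz hb
  have h3 := hp.primal_sub_le_dualityGap z.1 hz hb
  have hL := hp.Lhat_pos
  have hρ := hp.ρ_pos
  have hc : 0 < cConst L ρ := by unfold cConst; linarith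
  have h4 : 8 * Lhat L ρ / (53 * cConst L ρ) ≤ 1 / 31 := by
    rw [div_le_div_iff₀ (by positivity) (by norm_num)]
    unfold cConst
    linarith
  unfold lyapunov
  have := mul_le_mul h4 h2 h1 (by norm_num)
  linarith

end NCSCProblem

/-! ### The optimistic gradient method along a sample path -/

section Extragradient

variable {E : Type*} [NormedAddCommGroup E] [InnerProductSpace ℝ E]

/-- Nonexpansiveness of the projection, from the variational inequalities of the projections
`z` of `a` and `z'` of `a'`. -/
theorem norm_sub_le_of_inner_prox_nonneg {z z' a a' : E} (h : 0 ≤ inner ℝ (z - a) (z' - z))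
    (h' : 0 ≤ inner ℝ (z' - a') (z - z')) : ‖z - z'‖ ≤ ‖a - a'‖ := by
  have h1 : ‖z - z'‖ ^ 2 ≤ inner ℝ (a - a') (z - z') := by
    have h2 : inner ℝ (a - a') (z - z')
        = ‖z - z'‖ ^ 2 + (inner ℝ (z - a) (z' - z) + inner ℝ (z' - a') (z - z')) := by
      rw [← real_inner_self_eq_norm_sq, ← neg_sub z z', inner_neg_right]
      simp only [inner_sub_left]
      ring
    linarith
  have h2 := real_inner_le_norm (a - a') (z - z')
  by_contra! hlt
  nlinarith [norm_nonneg (a - a')]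

/-- The terms of the regret bound of the optimistic gradient method that are due to the noise `Θ`
at step `t + 1`, after `η ∑ ⟪Θ, u - z₀⟫` has been absorbed into `½ ‖u - z₀‖²`. -/
def ogdaNoise (η : ℝ) (z F Θ : ℕ → E) (t : ℕ) : ℝ :=
  2 * η ^ 2 * ‖Θ t‖ ^ 2 + 3 / 2 * η ^ 2 * ‖Θ (t + 1)‖ ^ 2
    + inner ℝ (Θ (t + 1)) ((2 * η ^ 2) • (F (t + 1) - F t - Θ t)
      - η • (z (t + 1) - (z 0 + η • ∑ s ∈ Finset.range t, Θ (s + 1))))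

/-- One step of the regret bound: `a`, `p` are the old iterates `z̃` and `z`, and `c`, `b` the new
ones; `q` is the auxiliary point `z₀ + η ∑ Θ`, which makes the bound uniform in `u`. -/
theorem ogda_step {η l : ℝ} (hη : 0 < η) (hηl : 8 * (η * l) ^ 2 ≤ 1) {a b c p q u F F' Θ Θ' : E}
    (hb : 0 ≤ inner ℝ (η • (F + Θ) + b - a) (c - b))
    (hc : 0 ≤ inner ℝ (η • (F' + Θ') + c - a) (u - c))
    (hc' : 0 ≤ inner ℝ (η • (F' + Θ') + c - a) (b - c))
    (hl : ‖F' - F‖ ≤ l * ‖b - p‖) :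
    η * inner ℝ F' (b - u) ≤ 1 / 2 * ‖u - a‖ ^ 2 - 1 / 2 * ‖u - c‖ ^ 2
      + 1 / 2 * ‖u - q‖ ^ 2 - 1 / 2 * ‖u - (q + η • Θ')‖ ^ 2
      + 1 / 2 * ‖a - p‖ ^ 2 - 1 / 2 * ‖c - b‖ ^ 2
      + (2 * η ^ 2 * ‖Θ‖ ^ 2 + 3 / 2 * η ^ 2 * ‖Θ'‖ ^ 2
        + inner ℝ Θ' ((2 * η ^ 2) • (F' - F - Θ) - η • (b - q))) := by
  -- the two prox-inequalities in three-point form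
  have h1 : η * inner ℝ (F' + Θ') (c - u)
      ≤ 1 / 2 * ‖u - a‖ ^ 2 - 1 / 2 * ‖u - c‖ ^ 2 - 1 / 2 * ‖c - a‖ ^ 2 := by
    have e1 : ‖u - a‖ ^ 2 = ‖u - c‖ ^ 2 + 2 * inner ℝ (c - a) (u - c) + ‖c - a‖ ^ 2 := by
      rw [← sub_add_sub_cancel u c a, norm_add_sq_real, real_inner_comm]
    rw [add_sub_assoc, inner_add_left, inner_smul_left, conj_trivial] at hc
    rw [← neg_sub u c, inner_neg_right]
    linarith
  have h2 : η * inner ℝ (F + Θ) (b - c)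
      ≤ 1 / 2 * ‖c - a‖ ^ 2 - 1 / 2 * ‖c - b‖ ^ 2 - 1 / 2 * ‖b - a‖ ^ 2 := by
    have e1 : ‖c - a‖ ^ 2 = ‖c - b‖ ^ 2 + 2 * inner ℝ (b - a) (c - b) + ‖b - a‖ ^ 2 := by
      rw [← sub_add_sub_cancel c b a, norm_add_sq_real, real_inner_comm]
    rw [add_sub_assoc, inner_add_left, inner_smul_left, conj_trivial] at hb
    rw [← neg_sub c b, inner_neg_right]
    linarith
  -- nonexpansiveness of the prox-mapping
  have h3 : ‖b - c‖ ≤ η * ‖F' + Θ' - (F + Θ)‖ := by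
    have := norm_sub_le_of_inner_prox_nonneg (z := b) (z' := c) (a := a - η • (F + Θ))
      (a' := a - η • (F' + Θ')) (by convert hb using 2; abel) (by convert hc' using 2; abel)
    rwa [sub_sub_sub_cancel_left, ← smul_sub, norm_smul, Real.norm_of_nonneg hη.le] at this
  have h4 : η * inner ℝ (F' + Θ' - (F + Θ)) (b - c) ≤ η ^ 2 * ‖F' + Θ' - (F + Θ)‖ ^ 2 := by
    have e1 := real_inner_le_norm (F' + Θ' - (F + Θ)) (b - c)
    have e2 := mul_le_mul_of_nonneg_left h3 (norm_nonneg (F' + Θ' - (F + Θ)))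
    nlinarith
  have h5 : ‖F' + Θ' - (F + Θ)‖ ^ 2
      = ‖F' - F - Θ‖ ^ 2 + 2 * inner ℝ Θ' (F' - F - Θ) + ‖Θ'‖ ^ 2 := by
    rw [show F' + Θ' - (F + Θ) = (F' - F - Θ) + Θ' by abel, norm_add_sq_real, real_inner_comm]
  have h6 : ‖F' - F - Θ‖ ^ 2 ≤ 2 * ‖F' - F‖ ^ 2 + 2 * ‖Θ‖ ^ 2 := by
    have := parallelogram_law_with_norm ℝ (F' - F) Θ
    nlinarith [mul_self_nonneg ‖F' - F + Θ‖]
  -- the step size is such that this is absorbed by the quadratic terms of the current and the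
  -- previous step
  have h7 : η ^ 2 * (2 * ‖F' - F‖ ^ 2) ≤ 1 / 2 * ‖b - a‖ ^ 2 + 1 / 2 * ‖a - p‖ ^ 2 := by
    have e1 : ‖F' - F‖ ^ 2 ≤ (l * ‖b - p‖) ^ 2 := pow_le_pow_left₀ (norm_nonneg _) hl 2
    have e2 : ‖b - p‖ ^ 2 ≤ 2 * ‖b - a‖ ^ 2 + 2 * ‖a - p‖ ^ 2 := by
      have := parallelogram_law_with_norm ℝ (b - a) (a - p)
      rw [sub_add_sub_cancel] at this
      nlinarith [mul_self_nonneg ‖b - a - (a - p)‖]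
    have e3 : η ^ 2 * (2 * ‖F' - F‖ ^ 2) ≤ 2 * (η * l) ^ 2 * ‖b - p‖ ^ 2 := by
      nlinarith [mul_le_mul_of_nonneg_left e1 (sq_nonneg η)]
    nlinarith [mul_le_mul_of_nonneg_right hηl (sq_nonneg ‖b - p‖)]
  -- the auxiliary sequence
  have h8 : ‖u - (q + η • Θ')‖ ^ 2 = ‖u - q‖ ^ 2 - 2 * (η * inner ℝ Θ' (u - q))
      + η ^ 2 * ‖Θ'‖ ^ 2 := by
    rw [← sub_sub, norm_sub_sq_real, inner_smul_right, norm_smul, mul_pow, Real.norm_of_nonneg hη.le,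
      real_inner_comm]
  have h9 : η * inner ℝ F' (b - u) = η * inner ℝ (F' + Θ') (c - u) + η * inner ℝ (F + Θ) (b - c)
      + η * inner ℝ (F' + Θ' - (F + Θ)) (b - c) - η * inner ℝ Θ' (b - q)
      + η * inner ℝ Θ' (u - q) := by
    simp only [inner_add_left, inner_sub_left, inner_sub_right]
    ring
  rw [inner_sub_right Θ', inner_smul_right, inner_smul_right]
  have h10 := mul_le_mul_of_nonneg_left h6 (sq_nonneg η)
  rw [h5] at h4
  linarith

/-- The regret bound of the optimistic gradient method, along a fixed sample path and
simultaneously for all comparison points `u`. -/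
theorem ogda_regret {η l : ℝ} (hη : 0 < η) (hηl : 8 * (η * l) ^ 2 ≤ 1) {S : Set E}
    {z zt F Θ : ℕ → E} (h0 : zt 0 = z 0) (hzS : ∀ t, z t ∈ S) (hztS : ∀ t, zt t ∈ S)
    (hz : ∀ t, ∀ u ∈ S, 0 ≤ inner ℝ (η • (F t + Θ t) + z (t + 1) - zt t) (u - z (t + 1)))
    (hzt : ∀ t, ∀ u ∈ S,
      0 ≤ inner ℝ (η • (F (t + 1) + Θ (t + 1)) + zt (t + 1) - zt t) (u - zt (t + 1)))
    (hl : ∀ t, ‖F (t + 1) - F t‖ ≤ l * ‖z (t + 1) - z t‖) {u : E} (hu : u ∈ S) (T : ℕ) :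
    η * ∑ t ∈ Finset.range T, inner ℝ (F (t + 1)) (z (t + 1) - u)
      ≤ ‖u - z 0‖ ^ 2 + ∑ t ∈ Finset.range T, ogdaNoise η z F Θ t := by
  have key : ∀ T : ℕ, η * ∑ t ∈ Finset.range T, inner ℝ (F (t + 1)) (z (t + 1) - u)
      ≤ ‖u - z 0‖ ^ 2 - 1 / 2 * ‖u - zt T‖ ^ 2
        - 1 / 2 * ‖u - (z 0 + η • ∑ s ∈ Finset.range T, Θ (s + 1))‖ ^ 2
        - 1 / 2 * ‖zt T - z T‖ ^ 2 + ∑ t ∈ Finset.range T, ogdaNoise η z F Θ t := by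
    intro T
    induction T with
    | zero =>
      simp only [Finset.range_zero, Finset.sum_empty, mul_zero, smul_zero, add_zero, h0, sub_self,
        norm_zero]
      linarith
    | succ T ih =>
      have hstep := ogda_step hη hηl (q := z 0 + η • ∑ s ∈ Finset.range T, Θ (s + 1))
        (hz T _ (hztS (T + 1))) (hzt T u hu) (hzt T _ (hzS (T + 1))) (hl T)
      rw [Finset.sum_range_succ, Finset.sum_range_succ, Finset.sum_range_succ, mul_add, smul_add,
        ← add_assoc (z 0)]
      simp only [ogdaNoise] at ih ⊢
      linarith
  nlinarith [key T, sq_nonneg ‖u - zt T‖, sq_nonneg ‖zt T - z T‖,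
    sq_nonneg ‖u - (z 0 + η • ∑ s ∈ Finset.range T, Θ (s + 1))‖]

end Extragradient

section ProxMap

/-- `ℝᵈ × ℝᵈ'` with the Euclidean norm `‖(x, y)‖² = ‖x‖² + ‖y‖²`. -/
abbrev VecPair (d d' : ℕ) : Type := WithLp 2 (Vec d × Vec d')

variable {d d' : ℕ} {Y : Set (Vec d')}

/-- The minimizer in the definition of `proxMap` exists, so that the junk branch is never taken. -/
theorem proxMap_spec (hYc : IsClosed Y) (hY : Y.Nonempty)
    (zbar g : Vec d × Vec d') :
    (proxMap Y zbar g).2 ∈ Y ∧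
      ∀ w : Vec d × Vec d', w.2 ∈ Y → proxMapObj zbar g (proxMap Y zbar g) ≤ proxMapObj zbar g w := by
  have hmin : ∀ {n : ℕ} {S : Set (Vec n)} (_ : IsClosed S) (_ : S.Nonempty) (a h : Vec n),
      ∃ x ∈ S, ∀ v ∈ S, inner ℝ h x + 1 / 2 * ‖x - a‖ ^ 2 ≤ inner ℝ h v + 1 / 2 * ‖v - a‖ ^ 2 := by
    intro n S hSc ⟨x₀, hx₀⟩ a h
    obtain ⟨x, hx, hxmin⟩ := exists_isMinOn_of_quadratic_lower_bound hSc
      (φ := fun v => inner ℝ h v + 1 / 2 * ‖v - a‖ ^ 2) (x₀ := x₀) (g := h + (x₀ - a)) (m := 1)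
      (by fun_prop) hx₀ one_pos (fun v _ => by
        have h2 : ‖v - a‖ ^ 2
            = ‖v - x₀‖ ^ 2 + 2 * inner ℝ (x₀ - a) (v - x₀) + ‖x₀ - a‖ ^ 2 := by
          rw [← sub_add_sub_cancel v x₀ a, norm_add_sq_real, real_inner_comm]
        rw [h2, inner_add_left, inner_sub_right]
        linarith)
    exact ⟨x, hx, fun v hv => hxmin hv⟩
  have hex : ∃ z : Vec d × Vec d', z.2 ∈ Y ∧ ∀ w : Vec d × Vec d', w.2 ∈ Y →
      proxMapObj zbar g z ≤ proxMapObj zbar g w := by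
    obtain ⟨x, -, hx⟩ := hmin isClosed_univ Set.univ_nonempty zbar.1 g.1
    obtain ⟨y, hy, hy'⟩ := hmin hYc hY zbar.2 g.2
    refine ⟨(x, y), hy, fun w hw => ?_⟩
    have h1 := hx w.1 (Set.mem_univ _)
    have h2 := hy' w.2 hw
    simp only [proxMapObj]
    linarith
  rw [proxMap, dif_pos hex]
  exact hex.choose_spec

theorem proxMapObj_eq (zbar g z : Vec d × Vec d') :
    proxMapObj zbar g z = inner ℝ (WithLp.toLp 2 g : VecPair d d') (WithLp.toLp 2 z)
      + 1 / 2 * ‖(WithLp.toLp 2 z : VecPair d d') - WithLp.toLp 2 zbar‖ ^ 2 := by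
  rw [WithLp.prod_inner_apply, WithLp.prod_norm_sq_eq_of_L2]
  rfl

/-- The variational inequality that characterizes the prox-mapping. -/
theorem proxMap_inner_nonneg (hYc : IsClosed Y) (hYx : Convex ℝ Y) (zbar g : Vec d × Vec d')
    {w : Vec d × Vec d'} (hw : w.2 ∈ Y) :
    0 ≤ inner ℝ ((WithLp.toLp 2 g : VecPair d d') + WithLp.toLp 2 (proxMap Y zbar g)
      - WithLp.toLp 2 zbar) (WithLp.toLp 2 w - WithLp.toLp 2 (proxMap Y zbar g)) := by
  obtain ⟨hzY, hmin⟩ := proxMap_spec hYc ⟨_, hw⟩ zbar g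
  set z := proxMap Y zbar g
  set G : VecPair d d' := WithLp.toLp 2 g
  set Z : VecPair d d' := WithLp.toLp 2 z with hZ
  set B : VecPair d d' := WithLp.toLp 2 zbar
  set W : VecPair d d' := WithLp.toLp 2 w with hW
  have key : ∀ t ∈ Set.Ioo (0 : ℝ) 1,
      0 ≤ inner ℝ (G + Z - B) (W - Z) + t * (1 / 2 * ‖W - Z‖ ^ 2) := by
    intro t ht
    have h1 := hmin (z + t • (w - z)) (by
      exact hYx.add_smul_sub_mem hzY hw ⟨ht.1.le, ht.2.le⟩)
    rw [proxMapObj_eq, proxMapObj_eq] at h1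
    have h2 : (WithLp.toLp 2 (z + t • (w - z)) : VecPair d d') = Z + t • (W - Z) := rfl
    rw [h2, show Z + t • (W - Z) - B = (Z - B) + t • (W - Z) by abel, norm_add_sq_real (Z - B),
      inner_add_right, inner_smul_right, inner_smul_right, norm_smul, mul_pow,
      Real.norm_of_nonneg ht.1.le] at h1
    rw [add_sub_assoc, inner_add_left]
    refine le_of_mul_le_mul_left ?_ ht.1
    linarith
  have hlim : Filter.Tendsto
      (fun t : ℝ => inner ℝ (G + Z - B) (W - Z) + t * (1 / 2 * ‖W - Z‖ ^ 2))
      (nhdsWithin 0 (Set.Ioi 0))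
      (nhds (inner ℝ (G + Z - B) (W - Z) + 0 * (1 / 2 * ‖W - Z‖ ^ 2))) :=
    ((by fun_prop : Continuous fun t : ℝ =>
      inner ℝ (G + Z - B) (W - Z) + t * (1 / 2 * ‖W - Z‖ ^ 2)).tendsto 0).mono_left
        nhdsWithin_le_nhds
  have := ge_of_tendsto hlim (by
    filter_upwards [Ioo_mem_nhdsGT (zero_lt_one' ℝ)] with t ht using key t ht)
  linarith

theorem norm_proxMap_sub_le (hYc : IsClosed Y) (hYx : Convex ℝ Y) (hY : Y.Nonempty)
    (a g a' g' : Vec d × Vec d') :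
    ‖(WithLp.toLp 2 (proxMap Y a g) : VecPair d d') - WithLp.toLp 2 (proxMap Y a' g')‖
      ≤ ‖(WithLp.toLp 2 (a - g) : VecPair d d') - WithLp.toLp 2 (a' - g')‖ := by
  have h := proxMap_inner_nonneg hYc hYx a g (proxMap_spec hYc hY a' g').1
  have h' := proxMap_inner_nonneg hYc hYx a' g' (proxMap_spec hYc hY a g).1
  refine norm_sub_le_of_inner_prox_nonneg ?_ ?_
  · convert h using 2
    rw [WithLp.toLp_sub]; abel
  · convert h' using 2
    rw [WithLp.toLp_sub]; abel

theorem norm_proxMap_sub_self_le (hYc : IsClosed Y) (hYx : Convex ℝ Y)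
    {a : Vec d × Vec d'} (ha : a.2 ∈ Y) (g : Vec d × Vec d') :
    ‖(WithLp.toLp 2 (proxMap Y a g) : VecPair d d') - WithLp.toLp 2 a‖
      ≤ ‖(WithLp.toLp 2 g : VecPair d d')‖ := by
  have h := proxMap_inner_nonneg hYc hYx a g ha
  have := norm_sub_le_of_inner_prox_nonneg (z := (WithLp.toLp 2 (proxMap Y a g) : VecPair d d'))
    (z' := WithLp.toLp 2 a) (a := WithLp.toLp 2 (a - g)) (a' := WithLp.toLp 2 a)
    (by convert h using 2; rw [WithLp.toLp_sub]; abel) (by simp)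
  rwa [WithLp.toLp_sub, sub_sub_cancel_left, norm_neg] at this

theorem continuous_proxMap (hYc : IsClosed Y) (hYx : Convex ℝ Y) (hY : Y.Nonempty) :
    Continuous fun p : (Vec d × Vec d') × (Vec d × Vec d') => proxMap Y p.1 p.2 := by
  have h : Continuous fun p : (Vec d × Vec d') × (Vec d × Vec d') =>
      (WithLp.toLp 2 (proxMap Y p.1 p.2) : VecPair d d') := by
    have hc : Continuous fun p : (Vec d × Vec d') × (Vec d × Vec d') =>
        (WithLp.toLp 2 (p.1 - p.2) : VecPair d d') := by fun_prop
    rw [Metric.continuous_iff] at hc ⊢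
    intro p ε hε
    obtain ⟨δ, hδ, h⟩ := hc p ε hε
    refine ⟨δ, hδ, fun q hq => lt_of_le_of_lt ?_ (h q hq)⟩
    rw [dist_eq_norm, dist_eq_norm]
    exact norm_proxMap_sub_le hYc hYx hY _ _ _ _
  exact (WithLp.prod_continuous_ofLp 2 _ _).comp h

end ProxMap

/-! ### Noise and independence of the past -/

section Noise

variable {α Ξ Ω V : Type*} [MeasurableSpace α] [MeasurableSpace Ξ] [MeasurableSpace Ω]
  [NormedAddCommGroup V]

theorem integrable_inner_of_memLp [InnerProductSpace ℝ V] {Pr : Measure Ω} {U W : Ω → V} (hU : MemLp U 2 Pr) (hW : MemLp W 2 Pr) :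
    Integrable (fun ω => inner ℝ (U ω) (W ω)) Pr := by
  have h := (hU.norm).integrable_mul (hW.norm)
  refine h.mono (hU.1.inner hW.1) (Filter.Eventually.of_forall fun ω => ?_)
  simpa using abs_real_inner_le_norm (U ω) (W ω)

variable [MeasurableSpace V] [BorelSpace V] [SecondCountableTopology V]
  {Pr : Measure Ω} [IsProbabilityMeasure Pr] {D : Measure Ξ} [IsProbabilityMeasure D]

/-- The noise of a sampled estimator with variance at most `v`, evaluated at a random point `U`
independent of the sample `X`, is square integrable. -/
theorem memLp_noise {H : α → Ξ → V} (hH : Measurable fun p : α × Ξ => H p.1 p.2) {Z : Set α}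
    {v : ℝ} (hint : ∀ a ∈ Z, Integrable (fun s => ‖H a s‖ ^ 2) D)
    (hv : ∀ a ∈ Z, ∫ s, ‖H a s‖ ^ 2 ∂D ≤ v)
    {U : Ω → α} {X : Ω → Ξ} (hU : Measurable U) (hUZ : ∀ ω, U ω ∈ Z) (hX : Measurable X)
    (hXD : Pr.map X = D) (hind : IndepFun U X Pr) :
    MemLp (fun ω => H (U ω) (X ω)) 2 Pr ∧ ∫ ω, ‖H (U ω) (X ω)‖ ^ 2 ∂Pr ≤ v := by
  have hm : Measurable fun ω => H (U ω) (X ω) := hH.comp (hU.prodMk hX)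
  have hlin : ∫⁻ ω, ENNReal.ofReal (‖H (U ω) (X ω)‖ ^ 2) ∂Pr ≤ ENNReal.ofReal v := by
    have hφ : Measurable fun p : α × Ξ => ENNReal.ofReal (‖H p.1 p.2‖ ^ 2) := by fun_prop
    have h1 := lintegral_map (μ := Pr) hφ (hU.prodMk hX)
    rw [← h1, (indepFun_iff_map_prod_eq_prod_map_map hU.aemeasurable hX.aemeasurable).1 hind, hXD,
      lintegral_prod _ hφ.aemeasurable, lintegral_map hφ.lintegral_prod_right' hU]
    calc ∫⁻ ω, ∫⁻ s, ENNReal.ofReal (‖H (U ω) s‖ ^ 2) ∂D ∂Pr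
        ≤ ∫⁻ _, ENNReal.ofReal v ∂Pr := by
          refine lintegral_mono fun ω => ?_
          rw [← ofReal_integral_eq_lintegral_ofReal (hint _ (hUZ ω))
            (Filter.Eventually.of_forall fun _ => by positivity)]
          exact ENNReal.ofReal_le_ofReal (hv _ (hUZ ω))
      _ = ENNReal.ofReal v := by simp
  have hi : Integrable (fun ω => ‖H (U ω) (X ω)‖ ^ 2) Pr := by
    refine ⟨(hm.norm.pow_const 2).aestronglyMeasurable, ?_⟩
    rw [hasFiniteIntegral_iff_ofReal (Filter.Eventually.of_forall fun _ => by positivity)]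
    exact hlin.trans_lt ENNReal.ofReal_lt_top
  refine ⟨(memLp_two_iff_integrable_sq_norm hm.aestronglyMeasurable).2 hi, ?_⟩
  rw [integral_eq_lintegral_of_nonneg_ae (Filter.Eventually.of_forall fun _ => by positivity) hi.1]
  have hne : Nonempty Ω := by
    by_contra hne
    rw [not_nonempty_iff] at hne
    exact IsProbabilityMeasure.ne_zero Pr (Measure.eq_zero_of_isEmpty Pr)
  have hv0 : 0 ≤ v := (integral_nonneg fun _ => by positivity).trans (hv _ (hUZ hne.some))
  exact (ENNReal.toReal_mono ENNReal.ofReal_ne_top hlin).trans_eq (ENNReal.toReal_ofReal hv0)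

/-- Centred noise is orthogonal to every square integrable vector that, together with the query
point, is independent of the sample. -/
theorem integral_inner_noise_eq_zero [InnerProductSpace ℝ V] [CompleteSpace V]
    {H : α → Ξ → V} (hH : Measurable fun p : α × Ξ => H p.1 p.2)
    {Z : Set α} (hint : ∀ a ∈ Z, Integrable (H a) D) (hzero : ∀ a ∈ Z, ∫ s, H a s ∂D = 0)
    {U : Ω → α} {X : Ω → Ξ} {W : Ω → V} (hU : Measurable U) (hUZ : ∀ ω, U ω ∈ Z)
    (hX : Measurable X) (hXD : Pr.map X = D) (hW : Measurable W)
    (hind : IndepFun (fun ω => (U ω, W ω)) X Pr)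
    (hi : Integrable (fun ω => inner ℝ (H (U ω) (X ω)) (W ω)) Pr) :
    ∫ ω, inner ℝ (H (U ω) (X ω)) (W ω) ∂Pr = 0 := by
  have hUW : Measurable fun ω => (U ω, W ω) := hU.prodMk hW
  have hφ : Measurable fun p : (α × V) × Ξ => (inner ℝ (H p.1.1 p.2) p.1.2 : ℝ) :=
    (hH.comp (by fun_prop : Measurable fun p : (α × V) × Ξ => (p.1.1, p.2))).inner (by fun_prop)
  have hmap := (indepFun_iff_map_prod_eq_prod_map_map hUW.aemeasurable hX.aemeasurable).1 hind
  have hprob : IsProbabilityMeasure (Pr.map fun ω => (U ω, W ω)) :=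
    Measure.isProbabilityMeasure_map hUW.aemeasurable
  have hi' : Integrable (fun p : (α × V) × Ξ => (inner ℝ (H p.1.1 p.2) p.1.2 : ℝ))
      ((Pr.map fun ω => (U ω, W ω)).prod D) := by
    rw [← hXD, ← hmap, integrable_map_measure hφ.aestronglyMeasurable
      (hUW.prodMk hX).aemeasurable]
    exact hi
  have h1 := integral_map (μ := Pr) (hUW.prodMk hX).aemeasurable
    hφ.aestronglyMeasurable
  rw [← h1, hmap, hXD, integral_prod _ hi',
    integral_map hUW.aemeasurable
      hφ.stronglyMeasurable.integral_prod_right'.aestronglyMeasurable]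
  refine integral_eq_zero_of_ae (Filter.Eventually.of_forall fun ω => ?_)
  simp only [Pi.zero_apply]
  have h2 := integral_inner (hint _ (hUZ ω)) (W ω) (𝕜 := ℝ)
  rw [hzero _ (hUZ ω), inner_zero_right] at h2
  rw [← h2]
  exact integral_congr_ae (Filter.Eventually.of_forall fun s => real_inner_comm _ _)

end Noise

section Past

variable {Ω Ξ : Type*} [MeasurableSpace Ξ]

/-- The `σ`-algebra generated by the samples that are drawn before sample `t` of stage `k`, in the
lexicographic order. -/
@[reducible] def samplePast (ξ : ℕ → ℕ → Ω → Ξ) (k t : ℕ) : MeasurableSpace Ω :=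
  ⨆ p ∈ {p : ℕ × ℕ | p.1 < k ∨ p.1 = k ∧ p.2 < t}, MeasurableSpace.comap (ξ p.1 p.2) inferInstance

variable {ξ : ℕ → ℕ → Ω → Ξ}

theorem samplePast_mono_right (k : ℕ) {t t' : ℕ} (h : t ≤ t') :
    samplePast ξ k t ≤ samplePast ξ k t' :=
  biSup_mono fun _ hp => hp.imp_right fun hp => ⟨hp.1, hp.2.trans_le h⟩

theorem samplePast_le_succ (k t : ℕ) : samplePast ξ k t ≤ samplePast ξ (k + 1) 0 :=
  biSup_mono fun p hp => by
    rcases hp with hp | hp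
    · exact Or.inl (hp.trans (Nat.lt_succ_self k))
    · exact Or.inl (hp.1.trans_lt (Nat.lt_succ_self k))

theorem measurable_sample_samplePast (k t : ℕ) :
    Measurable[samplePast ξ k (t + 1)] (ξ k t) := by
  refine Measurable.mono (comap_measurable (ξ k t)) ?_ le_rfl
  exact le_biSup (fun p : ℕ × ℕ => MeasurableSpace.comap (ξ p.1 p.2) inferInstance)
    (i := (k, t)) (Or.inr ⟨rfl, Nat.lt_succ_self t⟩)

theorem samplePast_le [MeasurableSpace Ω] (hξ : ∀ k t, Measurable (ξ k t)) (k t : ℕ) :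
    samplePast ξ k t ≤ (inferInstance : MeasurableSpace Ω) :=
  iSup₂_le fun p _ => (hξ p.1 p.2).comap_le

theorem indepFun_of_measurable_samplePast [MeasurableSpace Ω] {Pr : Measure Ω}
    (hξ : ∀ k t, Measurable (ξ k t))
    (hind : iIndepFun (fun p : ℕ × ℕ => ξ p.1 p.2) Pr) {β : Type*} [MeasurableSpace β] {U : Ω → β}
    {k t : ℕ} (hU : Measurable[samplePast ξ k t] U) : IndepFun U (ξ k t) Pr := by
  rw [IndepFun_iff_Indep]
  have h := indep_iSup_of_disjoint (fun p : ℕ × ℕ => (hξ p.1 p.2).comap_le) hind.iIndep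
    (S := {p : ℕ × ℕ | p.1 < k ∨ p.1 = k ∧ p.2 < t}) (T := {(k, t)}) (by
      rw [Set.disjoint_singleton_right]
      rintro (h | h)
      · exact lt_irrefl _ h
      · exact lt_irrefl _ h.2)
  refine indep_of_indep_of_le_left (indep_of_indep_of_le_right h ?_) hU.comap_le
  exact le_biSup (fun p : ℕ × ℕ => MeasurableSpace.comap (ξ p.1 p.2) inferInstance)
    (i := (k, t)) rfl

end Past

/-! ### The iterates of a stage -/

section Stage

variable {d d' : ℕ} {f : Vec d → Vec d' → ℝ} {gx : Vec d → Vec d' → Vec d}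
  {gy : Vec d → Vec d' → Vec d'} {Y : Set (Vec d')} {l μy L ρ μ : ℝ} {xstar : Vec d}
  {Ξ : Type*} [MeasurableSpace Ξ] {D : Measure Ξ}
  {Gx : Vec d → Vec d' → Ξ → Vec d} {Gy : Vec d → Vec d' → Ξ → Vec d'} {σ : ℝ}

/-- The operator `(∇ₓ f(z) + γ (x - x₀), -∇_y f(z))` of the proximal objective with centre `x₀`. -/
def gradOp (gx : Vec d → Vec d' → Vec d) (gy : Vec d → Vec d' → Vec d') (γ : ℝ) (x₀ : Vec d)
    (z : Vec d × Vec d') : VecPair d d' :=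
  WithLp.toLp 2 (gx z.1 z.2 + γ • (z.1 - x₀), -gy z.1 z.2)

/-- The error of the stochastic operator; it does not depend on the centre. -/
def gradNoise (gx : Vec d → Vec d' → Vec d) (gy : Vec d → Vec d' → Vec d')
    (Gx : Vec d → Vec d' → Ξ → Vec d) (Gy : Vec d → Vec d' → Ξ → Vec d') (z : Vec d × Vec d')
    (s : Ξ) : VecPair d d' :=
  WithLp.toLp 2 (Gx z.1 z.2 s - gx z.1 z.2, -(Gy z.1 z.2 s - gy z.1 z.2))

omit [MeasurableSpace Ξ] in
theorem toLp_stochOp (γ : ℝ) (x₀ : Vec d) (z : Vec d × Vec d') (s : Ξ) :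
    (WithLp.toLp 2 (stochOp Gx Gy γ x₀ z s) : VecPair d d')
      = gradOp gx gy γ x₀ z + gradNoise gx gy Gx Gy z s := by
  rw [gradOp, gradNoise, ← WithLp.toLp_add, stochOp, Prod.mk_add_mk]
  congr 2 <;> abel

theorem NCSCProblem.norm_gradOp_sub_le (hp : NCSCProblem f gx gy Y l μy L ρ μ xstar) {γ : ℝ}
    (hγ : 0 ≤ γ) (x₀ x₁ : Vec d) {z z' : Vec d × Vec d'} (hz : z.2 ∈ Y) (hz' : z'.2 ∈ Y) :
    ‖gradOp gx gy γ x₀ z - gradOp gx gy γ x₁ z'‖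
      ≤ (l + γ) * ‖(WithLp.toLp 2 z : VecPair d d') - WithLp.toLp 2 z'‖ + γ * ‖x₀ - x₁‖ := by
  have hdec : gradOp gx gy γ x₀ z - gradOp gx gy γ x₁ z'
      = (WithLp.toLp 2 (gx z.1 z.2 - gx z'.1 z'.2, -(gy z.1 z.2 - gy z'.1 z'.2)) : VecPair d d')
        + (WithLp.toLp 2 (γ • (z.1 - z'.1 - (x₀ - x₁)), 0) : VecPair d d') := by
    refine WithLp.ofLp_injective 2 (Prod.ext ?_ ?_)
    · change gx z.1 z.2 + γ • (z.1 - x₀) - (gx z'.1 z'.2 + γ • (z'.1 - x₁))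
        = gx z.1 z.2 - gx z'.1 z'.2 + γ • (z.1 - z'.1 - (x₀ - x₁))
      simp only [smul_sub]; abel
    · change -gy z.1 z.2 - -gy z'.1 z'.2 = -(gy z.1 z.2 - gy z'.1 z'.2) + 0
      abel
  have h1 : ‖(WithLp.toLp 2 (gx z.1 z.2 - gx z'.1 z'.2, -(gy z.1 z.2 - gy z'.1 z'.2)) :
      VecPair d d')‖ ≤ l * ‖(WithLp.toLp 2 z : VecPair d d') - WithLp.toLp 2 z'‖ := by
    rw [WithLp.prod_norm_eq_of_L2, WithLp.prod_norm_eq_of_L2]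
    have h := hp.lipschitz z.1 z.2 hz z'.1 z'.2 hz'
    rw [← norm_neg (gy z.1 z.2 - gy z'.1 z'.2)] at h
    exact h
  have h2 : ‖(WithLp.toLp 2 (γ • (z.1 - z'.1 - (x₀ - x₁)), 0) : VecPair d d')‖
      ≤ γ * (‖(WithLp.toLp 2 z : VecPair d d') - WithLp.toLp 2 z'‖ + ‖x₀ - x₁‖) := by
    have h3 : ‖z.1 - z'.1‖ ≤ ‖(WithLp.toLp 2 z : VecPair d d') - WithLp.toLp 2 z'‖ :=
      WithLp.norm_fst_le _ ((WithLp.toLp 2 z : VecPair d d') - WithLp.toLp 2 z')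
    rw [WithLp.norm_toLp_fst, norm_smul, Real.norm_of_nonneg hγ]
    have := norm_sub_le (z.1 - z'.1) (x₀ - x₁)
    gcongr
    linarith
  rw [hdec]
  refine (norm_add_le _ _).trans ?_
  linarith

/-- The partial gradients are unconstrained off `ℝᵈ × Y`; on it they agree with the mean of the
estimators, which is measurable. -/
theorem StochasticGradient.exists_measurable_grad [IsProbabilityMeasure D]
    (hs : StochasticGradient D gx gy Y Gx Gy σ) :
    ∃ g : Vec d × Vec d' → Vec d × Vec d', Measurable g ∧
      ∀ z : Vec d × Vec d', z.2 ∈ Y → g z = (gx z.1 z.2, gy z.1 z.2) := by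
  refine ⟨fun z => (∫ s, Gx z.1 z.2 s ∂D, ∫ s, Gy z.1 z.2 s ∂D), ?_, fun z hz => ?_⟩
  · exact (hs.measurable_x.stronglyMeasurable.integral_prod_right'.measurable).prodMk
      (hs.measurable_y.stronglyMeasurable.integral_prod_right'.measurable)
  · exact Prod.ext (hs.unbiased_x z.1 z.2 hz) (hs.unbiased_y z.1 z.2 hz)

/-- A jointly measurable version of the noise, with its first two moments on `ℝᵈ × Y`. -/
theorem StochasticGradient.exists_measurable_noise [IsProbabilityMeasure D]
    (hs : StochasticGradient D gx gy Y Gx Gy σ) :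
    ∃ H : Vec d × Vec d' → Ξ → VecPair d d',
      (Measurable fun p : (Vec d × Vec d') × Ξ => H p.1 p.2) ∧
      (∀ z ∈ {z : Vec d × Vec d' | z.2 ∈ Y}, ∀ s, H z s = gradNoise gx gy Gx Gy z s) ∧
      (∀ z ∈ {z : Vec d × Vec d' | z.2 ∈ Y}, Integrable (H z) D) ∧
      (∀ z ∈ {z : Vec d × Vec d' | z.2 ∈ Y}, ∫ s, H z s ∂D = 0) ∧
      (∀ z ∈ {z : Vec d × Vec d' | z.2 ∈ Y}, Integrable (fun s => ‖H z s‖ ^ 2) D) ∧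
      (∀ z ∈ {z : Vec d × Vec d' | z.2 ∈ Y}, ∫ s, ‖H z s‖ ^ 2 ∂D ≤ 2 * σ ^ 2) := by
  obtain ⟨g, hg, hgeq⟩ := hs.exists_measurable_grad
  set H : Vec d × Vec d' → Ξ → VecPair d d' := fun z s =>
    WithLp.toLp 2 (Gx z.1 z.2 s - (g z).1, -(Gy z.1 z.2 s - (g z).2)) with hH
  have heq : ∀ z : Vec d × Vec d', z.2 ∈ Y → ∀ s, H z s = gradNoise gx gy Gx Gy z s := by
    intro z hz s
    rw [hH, gradNoise]
    simp only [hgeq z hz]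
  have hx := hs.measurable_x
  have hy := hs.measurable_y
  have hpair : ∀ z : Vec d × Vec d', z.2 ∈ Y → Integrable
      (fun s => (Gx z.1 z.2 s - gx z.1 z.2, -(Gy z.1 z.2 s - gy z.1 z.2))) D := fun z hz =>
    ((hs.integrable_x z.1 z.2 hz).sub (integrable_const _)).prodMk
      ((hs.integrable_y z.1 z.2 hz).sub (integrable_const _)).neg
  have hsq : ∀ z : Vec d × Vec d', z.2 ∈ Y → ∀ s, ‖H z s‖ ^ 2
      = ‖Gx z.1 z.2 s - gx z.1 z.2‖ ^ 2 + ‖Gy z.1 z.2 s - gy z.1 z.2‖ ^ 2 := by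
    intro z hz s
    rw [heq z hz, gradNoise, WithLp.prod_norm_sq_eq_of_L2, WithLp.toLp_fst, WithLp.toLp_snd,
      norm_neg]
  refine ⟨H, ?_, heq, fun z hz => ?_, fun z hz => ?_, fun z hz => ?_, fun z hz => ?_⟩
  · exact (WithLp.measurable_toLp 2 _).comp
      ((hx.sub (hg.comp measurable_fst).fst).prodMk (hy.sub (hg.comp measurable_fst).snd).neg)
  · rw [funext (heq z hz)]
    exact (WithLp.prodContinuousLinearEquiv 2 ℝ (Vec d) (Vec d')).symm.toContinuousLinearMap
      |>.integrable_comp (hpair z hz)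
  · rw [funext (heq z hz)]
    have h1 := (WithLp.prodContinuousLinearEquiv 2 ℝ (Vec d)
      (Vec d')).symm.toContinuousLinearMap.integral_comp_comm (hpair z hz)
    refine h1.trans ?_
    rw [integral_pair (f := fun s => Gx z.1 z.2 s - gx z.1 z.2)
      (g := fun s => -(Gy z.1 z.2 s - gy z.1 z.2))
      ((hs.integrable_x z.1 z.2 hz).sub (integrable_const _))
      ((hs.integrable_y z.1 z.2 hz).sub (integrable_const _)).neg, integral_neg,
      integral_sub (hs.integrable_x z.1 z.2 hz) (integrable_const _),
      integral_sub (hs.integrable_y z.1 z.2 hz) (integrable_const _),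
      hs.unbiased_x z.1 z.2 hz, hs.unbiased_y z.1 z.2 hz]
    simp
  · rw [funext (hsq z hz)]
    exact (hs.integrable_sq_x z.1 z.2 hz).add (hs.integrable_sq_y z.1 z.2 hz)
  · rw [funext (hsq z hz), integral_add (hs.integrable_sq_x z.1 z.2 hz)
      (hs.integrable_sq_y z.1 z.2 hz)]
    linarith [hs.variance_x z.1 z.2 hz, hs.variance_y z.1 z.2 hz]

variable {Ω : Type*}

theorem StochasticGradient.measurable_gradNoise [IsProbabilityMeasure D]
    (hs : StochasticGradient D gx gy Y Gx Gy σ) {m : MeasurableSpace Ω} {U : Ω → Vec d × Vec d'}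
    (hU : Measurable[m] U) (hUY : ∀ ω, (U ω).2 ∈ Y) {X : Ω → Ξ} (hX : Measurable[m] X) :
    Measurable[m] fun ω => gradNoise gx gy Gx Gy (U ω) (X ω) := by
  obtain ⟨H, hH, heq, -⟩ := hs.exists_measurable_noise
  have h : (fun ω => gradNoise gx gy Gx Gy (U ω) (X ω)) = fun ω => H (U ω) (X ω) :=
    funext fun ω => (heq _ (hUY ω) _).symm
  rw [h]
  exact hH.comp (hU.prodMk hX)

theorem StochasticGradient.measurable_gradOp [IsProbabilityMeasure D]
    (hs : StochasticGradient D gx gy Y Gx Gy σ) (γ : ℝ) {m : MeasurableSpace Ω}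
    {w U : Ω → Vec d × Vec d'} (hw : Measurable[m] w)
    (hU : Measurable[m] U) (hUY : ∀ ω, (U ω).2 ∈ Y) :
    Measurable[m] fun ω => gradOp gx gy γ (w ω).1 (U ω) := by
  obtain ⟨g, hg, heq⟩ := hs.exists_measurable_grad
  have h : (fun ω => gradOp gx gy γ (w ω).1 (U ω)) = fun ω =>
      WithLp.toLp 2 ((g (U ω)).1 + γ • ((U ω).1 - (w ω).1), -(g (U ω)).2) := by
    funext ω
    rw [gradOp, heq _ (hUY ω)]
  rw [h]
  exact (WithLp.measurable_toLp 2 _).comp (((hg.comp hU).fst.add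
    ((hU.fst.sub hw.fst).const_smul γ)).prodMk (hg.comp hU).snd.neg)

theorem StochasticGradient.measurable_stochOp (hs : StochasticGradient D gx gy Y Gx Gy σ) (γ : ℝ) :
    Measurable fun p : (Vec d × (Vec d × Vec d')) × Ξ => stochOp Gx Gy γ p.1.1 p.1.2 p.2 := by
  have h : Measurable fun p : (Vec d × (Vec d × Vec d')) × Ξ => (p.1.2, p.2) :=
    measurable_fst.snd.prodMk measurable_snd
  have h1 := hs.measurable_x.comp h
  have h2 := hs.measurable_y.comp h
  have h3 : Measurable fun p : (Vec d × (Vec d × Vec d')) × Ξ => γ • (p.1.2.1 - p.1.1) :=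
    (measurable_fst.snd.fst.sub measurable_fst.fst).const_smul γ
  exact (h1.add h3).prodMk h2.neg

/-- The iterates `(z_t, z̃_t)` of stage `k`, started at the random point `w`. -/
def stageIter (Y : Set (Vec d')) (Gx : Vec d → Vec d' → Ξ → Vec d)
    (Gy : Vec d → Vec d' → Ξ → Vec d') (γ η : ℝ) (ξ : ℕ → ℕ → Ω → Ξ) (k : ℕ)
    (w : Ω → Vec d × Vec d') (t : ℕ) (ω : Ω) : (Vec d × Vec d') × (Vec d × Vec d') :=
  ogda Y (fun z t => stochOp Gx Gy γ (w ω).1 z (ξ k t ω)) η (w ω) t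

omit [MeasurableSpace Ξ] in
theorem stageIter_mem (hYc : IsClosed Y) {γ η : ℝ} {ξ : ℕ → ℕ → Ω → Ξ} {k : ℕ} {w : Ω → Vec d × Vec d'}
    (hwY : ∀ ω, (w ω).2 ∈ Y) (t : ℕ) (ω : Ω) :
    (stageIter Y Gx Gy γ η ξ k w t ω).1.2 ∈ Y ∧ (stageIter Y Gx Gy γ η ξ k w t ω).2.2 ∈ Y := by
  cases t with
  | zero => exact ⟨hwY ω, hwY ω⟩
  | succ t => exact ⟨(proxMap_spec hYc ⟨_, hwY ω⟩ _ _).1, (proxMap_spec hYc ⟨_, hwY ω⟩ _ _).1⟩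

theorem measurable_stageIter (hp : NCSCProblem f gx gy Y l μy L ρ μ xstar)
    (hs : StochasticGradient D gx gy Y Gx Gy σ) {γ η : ℝ}
    {ξ : ℕ → ℕ → Ω → Ξ} {k : ℕ} {w : Ω → Vec d × Vec d'}
    (hY : Y.Nonempty) (hw : Measurable[samplePast ξ k 0] w) (t : ℕ) :
    (Measurable[samplePast ξ k t] fun ω => (stageIter Y Gx Gy γ η ξ k w t ω).1) ∧
      Measurable[samplePast ξ k (t + 1)] fun ω => (stageIter Y Gx Gy γ η ξ k w t ω).2 := by
  have hprox := (continuous_proxMap (d := d) hp.isClosed hp.convex hY).measurable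
  have hop := hs.measurable_stochOp γ
  induction t with
  | zero => exact ⟨hw, hw.mono (samplePast_mono_right k (Nat.zero_le _)) le_rfl⟩
  | succ t ih =>
    have hstep : ∀ (s : ℕ) {U V : Ω → Vec d × Vec d'}, Measurable[samplePast ξ k (s + 1)] U →
        Measurable[samplePast ξ k (s + 1)] V → Measurable[samplePast ξ k (s + 1)] fun ω =>
          proxMap Y (U ω) (η • stochOp Gx Gy γ (w ω).1 (V ω) (ξ k s ω)) := by
      intro s U V hU hV
      have hw' : Measurable[samplePast ξ k (s + 1)] w :=
        hw.mono (samplePast_mono_right k (Nat.zero_le _)) le_rfl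
      have hG : Measurable[samplePast ξ k (s + 1)] fun ω =>
          stochOp Gx Gy γ (w ω).1 (V ω) (ξ k s ω) :=
        hop.comp ((hw'.fst.prodMk hV).prodMk (measurable_sample_samplePast k s))
      have hG' : Measurable[samplePast ξ k (s + 1)] fun ω =>
          η • stochOp Gx Gy γ (w ω).1 (V ω) (ξ k s ω) :=
        (measurable_const_smul η).comp hG
      have h := hprox.comp (hU.prodMk hG')
      exact h
    have hz : Measurable[samplePast ξ k (t + 1)] fun ω =>
        (stageIter Y Gx Gy γ η ξ k w (t + 1) ω).1 :=
      hstep t ih.2 (ih.1.mono (samplePast_mono_right k (Nat.le_succ t)) le_rfl)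
    exact ⟨hz, hstep (t + 1) (ih.2.mono (samplePast_mono_right k (Nat.le_succ _)) le_rfl)
      (hz.mono (samplePast_mono_right k (Nat.le_succ _)) le_rfl)⟩

variable [MeasurableSpace Ω] {Pr : Measure Ω} [IsProbabilityMeasure Pr] {ξ : ℕ → ℕ → Ω → Ξ}

theorem StochasticGradient.memLp_gradNoise [IsProbabilityMeasure D]
    (hs : StochasticGradient D gx gy Y Gx Gy σ) (hξ : ∀ k t, Measurable (ξ k t))
    (hξD : ∀ k t, Pr.map (ξ k t) = D) (hind : iIndepFun (fun p : ℕ × ℕ => ξ p.1 p.2) Pr)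
    {k t : ℕ} {U : Ω → Vec d × Vec d'} (hU : Measurable[samplePast ξ k t] U)
    (hUY : ∀ ω, (U ω).2 ∈ Y) :
    MemLp (fun ω => gradNoise gx gy Gx Gy (U ω) (ξ k t ω)) 2 Pr ∧
      ∫ ω, ‖gradNoise gx gy Gx Gy (U ω) (ξ k t ω)‖ ^ 2 ∂Pr ≤ 2 * σ ^ 2 := by
  obtain ⟨H, hH, heq, -, -, hint, hv⟩ := hs.exists_measurable_noise
  simp only [fun ω => (heq _ (hUY ω) (ξ k t ω)).symm]
  exact memLp_noise hH hint hv (hU.mono (samplePast_le hξ k t) le_rfl) hUY (hξ k t) (hξD k t)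
    (indepFun_of_measurable_samplePast hξ hind hU)

theorem StochasticGradient.integral_inner_gradNoise [IsProbabilityMeasure D]
    (hs : StochasticGradient D gx gy Y Gx Gy σ) (hξ : ∀ k t, Measurable (ξ k t))
    (hξD : ∀ k t, Pr.map (ξ k t) = D) (hind : iIndepFun (fun p : ℕ × ℕ => ξ p.1 p.2) Pr)
    {k t : ℕ} {U : Ω → Vec d × Vec d'} (hU : Measurable[samplePast ξ k t] U)
    (hUY : ∀ ω, (U ω).2 ∈ Y) {W : Ω → VecPair d d'} (hW : Measurable[samplePast ξ k t] W)
    (hW2 : MemLp W 2 Pr) :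
    ∫ ω, inner ℝ (gradNoise gx gy Gx Gy (U ω) (ξ k t ω)) (W ω) ∂Pr = 0 := by
  have hi := integrable_inner_of_memLp (hs.memLp_gradNoise hξ hξD hind hU hUY).1 hW2
  obtain ⟨H, hH, heq, hint, hzero, -, -⟩ := hs.exists_measurable_noise
  simp only [fun ω => (heq _ (hUY ω) (ξ k t ω)).symm] at hi ⊢
  exact integral_inner_noise_eq_zero hH hint hzero (hU.mono (samplePast_le hξ k t) le_rfl) hUY
    (hξ k t) (hξD k t) (hW.mono (samplePast_le hξ k t) le_rfl)
    (indepFun_of_measurable_samplePast hξ hind (hU.prodMk hW)) hi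

theorem memLp_gradOp [IsProbabilityMeasure D] (hp : NCSCProblem f gx gy Y l μy L ρ μ xstar)
    (hs : StochasticGradient D gx gy Y Gx Gy σ) {γ : ℝ} (hγ : 0 ≤ γ)
    {w U : Ω → Vec d × Vec d'} (hw : Measurable w) (hU : Measurable U) (hUY : ∀ ω, (U ω).2 ∈ Y)
    (hw2 : MemLp (fun ω => (WithLp.toLp 2 (w ω) : VecPair d d')) 2 Pr)
    (hU2 : MemLp (fun ω => (WithLp.toLp 2 (U ω) : VecPair d d')) 2 Pr) :
    MemLp (fun ω => gradOp gx gy γ (w ω).1 (U ω)) 2 Pr := by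
  have hne : Nonempty Ω := by
    by_contra hne
    rw [not_nonempty_iff] at hne
    exact IsProbabilityMeasure.ne_zero Pr (Measure.eq_zero_of_isEmpty Pr)
  set a : Vec d × Vec d' := U hne.some with ha
  have hl : 0 ≤ l := hp.ρ_pos.le.trans hp.ρ_le
  have hbd : MemLp (fun ω => (l + γ) * ‖(WithLp.toLp 2 (U ω) : VecPair d d') - WithLp.toLp 2 a‖
      + γ * ‖(WithLp.toLp 2 (w ω) : VecPair d d')‖ + ‖gradOp gx gy γ 0 a‖) 2 Pr :=
    (((hU2.sub (memLp_const _)).norm.const_mul _).add (hw2.norm.const_mul _)).add (memLp_const _)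
  refine hbd.mono' (hs.measurable_gradOp γ hw hU hUY).aestronglyMeasurable
    (Filter.Eventually.of_forall fun ω => ?_)
  have h1 := hp.norm_gradOp_sub_le hγ (w ω).1 0 (hUY ω) (hUY hne.some)
  have h2 : ‖(w ω).1‖ ≤ ‖(WithLp.toLp 2 (w ω) : VecPair d d')‖ :=
    WithLp.norm_fst_le _ (WithLp.toLp 2 (w ω) : VecPair d d')
  have h3 := norm_sub_norm_le (gradOp gx gy γ (w ω).1 (U ω)) (gradOp gx gy γ 0 a)
  rw [sub_zero] at h1
  have h4 := mul_le_mul_of_nonneg_left h2 hγ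
  linarith

theorem memLp_stageIter [IsProbabilityMeasure D] (hp : NCSCProblem f gx gy Y l μy L ρ μ xstar)
    (hs : StochasticGradient D gx gy Y Gx Gy σ) (hξ : ∀ k t, Measurable (ξ k t))
    (hξD : ∀ k t, Pr.map (ξ k t) = D) (hind : iIndepFun (fun p : ℕ × ℕ => ξ p.1 p.2) Pr)
    {γ η : ℝ} (hγ : 0 ≤ γ) {k : ℕ} {w : Ω → Vec d × Vec d'}
    (hY : Y.Nonempty) (hw : Measurable[samplePast ξ k 0] w) (hwY : ∀ ω, (w ω).2 ∈ Y)
    (hw2 : MemLp (fun ω => (WithLp.toLp 2 (w ω) : VecPair d d')) 2 Pr) (t : ℕ) :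
    MemLp (fun ω => (WithLp.toLp 2 (stageIter Y Gx Gy γ η ξ k w t ω).1 : VecPair d d')) 2 Pr ∧
      MemLp (fun ω => (WithLp.toLp 2 (stageIter Y Gx Gy γ η ξ k w t ω).2 : VecPair d d')) 2 Pr := by
  have hmeas := fun t => measurable_stageIter (γ := γ) (η := η) hp hs hY hw t
  have hmem := fun t => stageIter_mem (Gx := Gx) (Gy := Gy) (γ := γ) (η := η) (ξ := ξ) (k := k)
    hp.isClosed hwY t
  have hop : ∀ (s : ℕ) {U : Ω → Vec d × Vec d'}, Measurable[samplePast ξ k s] U →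
      (∀ ω, (U ω).2 ∈ Y) → MemLp (fun ω => (WithLp.toLp 2 (U ω) : VecPair d d')) 2 Pr →
      MemLp (fun ω => (WithLp.toLp 2 (η • stochOp Gx Gy γ (w ω).1 (U ω) (ξ k s ω)) :
        VecPair d d')) 2 Pr := by
    intro s U hU hUY hU2
    have h1 := memLp_gradOp hp hs hγ (hw.mono (samplePast_le hξ _ _) le_rfl)
      (hU.mono (samplePast_le hξ _ _) le_rfl) hUY hw2 hU2
    have h2 := (hs.memLp_gradNoise hξ hξD hind hU hUY).1
    simp only [WithLp.toLp_smul, toLp_stochOp (gx := gx) (gy := gy)]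
    exact (h1.add h2).const_smul η
  have hprox : ∀ {U V : Ω → Vec d × Vec d'}, (∀ ω, (U ω).2 ∈ Y) →
      Measurable (fun ω => proxMap Y (U ω) (V ω)) →
      MemLp (fun ω => (WithLp.toLp 2 (U ω) : VecPair d d')) 2 Pr →
      MemLp (fun ω => (WithLp.toLp 2 (V ω) : VecPair d d')) 2 Pr →
      MemLp (fun ω => (WithLp.toLp 2 (proxMap Y (U ω) (V ω)) : VecPair d d')) 2 Pr := by
    intro U V hUY hm hU2 hV2
    refine (hU2.norm.add hV2.norm).mono'
      ((WithLp.measurable_toLp 2 _).comp hm).aestronglyMeasurable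
      (Filter.Eventually.of_forall fun ω => ?_)
    have h1 := norm_proxMap_sub_self_le hp.isClosed hp.convex (hUY ω) (V ω)
    have h2 := norm_sub_norm_le (WithLp.toLp 2 (proxMap Y (U ω) (V ω)) : VecPair d d')
      (WithLp.toLp 2 (U ω))
    simp only [Pi.add_apply]
    linarith
  induction t with
  | zero => exact ⟨hw2, hw2⟩
  | succ t ih =>
    have hz := hprox (fun ω => (hmem t ω).2) ((hmeas (t + 1)).1.mono (samplePast_le hξ _ _) le_rfl)
      ih.2 (hop t (hmeas t).1 (fun ω => (hmem t ω).1) ih.1)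
    exact ⟨hz, hprox (fun ω => (hmem t ω).2) ((hmeas (t + 1)).2.mono (samplePast_le hξ _ _) le_rfl)
      ih.2 (hop (t + 1) (hmeas (t + 1)).1 (fun ω => (hmem (t + 1) ω).1) hz)⟩

end Stage

/-! ### The bound for one stage -/

theorem sum_Icc_one_eq_sum_range {M : Type*} [AddCommMonoid M] (a : ℕ → M) (T : ℕ) :
    ∑ t ∈ Finset.Icc 1 T, a t = ∑ t ∈ Finset.range T, a (t + 1) := by
  induction T with
  | zero => simp
  | succ T ih => rw [Finset.sum_Icc_succ_top (by omega), Finset.sum_range_succ, ih]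

section StageBound

variable {d d' : ℕ} {f : Vec d → Vec d' → ℝ} {gx : Vec d → Vec d' → Vec d}
  {gy : Vec d → Vec d' → Vec d'} {Y : Set (Vec d')} {l μy L ρ μ : ℝ} {xstar : Vec d}

theorem snd_average_mem (hYx : Convex ℝ Y) {T : ℕ} (hT : 0 < T) {z : ℕ → Vec d × Vec d'}
    (hz : ∀ t, (z t).2 ∈ Y) : ((T : ℝ)⁻¹ • ∑ t ∈ Finset.range T, z (t + 1)).2 ∈ Y := by
  rw [Prod.smul_snd, Prod.snd_sum, Finset.smul_sum]
  refine hYx.sum_mem (fun _ _ => by positivity) ?_ (fun t _ => hz (t + 1))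
  have : (T : ℝ) ≠ 0 := by positivity
  simp [this]

/-- Convexity in `x` and concavity in `y` bound the gap at the average of the iterates by the
averaged linearization. -/
theorem NCSCProblem.proxObj_average_sub_le (hp : NCSCProblem f gx gy Y l μy L ρ μ xstar)
    (w : Vec d) {T : ℕ} (hT : 0 < T) {z : ℕ → Vec d × Vec d'} (hz : ∀ t, (z t).2 ∈ Y)
    {zbar : Vec d × Vec d'} (hzbar : zbar = (T : ℝ)⁻¹ • ∑ t ∈ Finset.range T, z (t + 1))
    (x : Vec d) {y : Vec d'} (hy : y ∈ Y) :
    T * (proxObj f (2 * ρ) w zbar.1 y - proxObj f (2 * ρ) w x zbar.2)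
      ≤ ∑ t ∈ Finset.range T, inner ℝ (gradOp gx gy (2 * ρ) w (z (t + 1)))
          ((WithLp.toLp 2 (z (t + 1)) : VecPair d d') - WithLp.toLp 2 (x, y)) := by
  have hT0 : (T : ℝ) ≠ 0 := by positivity
  have hbarY : zbar.2 ∈ Y := hzbar ▸ snd_average_mem hp.convex hT hz
  have hsum : ∑ t ∈ Finset.range T, z (t + 1) = (T : ℝ) • zbar := by
    rw [hzbar, smul_inv_smul₀ hT0]
  have hsum1 : ∑ t ∈ Finset.range T, ((z (t + 1)).1 - zbar.1) = 0 := by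
    have := congrArg Prod.fst hsum
    rw [Prod.fst_sum, Prod.smul_fst] at this
    rw [Finset.sum_sub_distrib, this, Finset.sum_const, Finset.card_range, Nat.cast_smul_eq_nsmul,
      sub_self]
  have hsum2 : ∑ t ∈ Finset.range T, ((z (t + 1)).2 - zbar.2) = 0 := by
    have := congrArg Prod.snd hsum
    rw [Prod.snd_sum, Prod.smul_snd] at this
    rw [Finset.sum_sub_distrib, this, Finset.sum_const, Finset.card_range, Nat.cast_smul_eq_nsmul,
      sub_self]
  have hterm : ∀ t ∈ Finset.range T,
      (proxObj f (2 * ρ) w zbar.1 y - proxObj f (2 * ρ) w x zbar.2)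
        + (inner ℝ (gx zbar.1 y + (2 * ρ) • (zbar.1 - w)) ((z (t + 1)).1 - zbar.1)
          - inner ℝ (gy x zbar.2) ((z (t + 1)).2 - zbar.2))
      ≤ inner ℝ (gradOp gx gy (2 * ρ) w (z (t + 1)))
          ((WithLp.toLp 2 (z (t + 1)) : VecPair d d') - WithLp.toLp 2 (x, y)) := by
    intro t _
    have hzt := hz (t + 1)
    set p := z (t + 1)
    have hin : inner ℝ (gradOp gx gy (2 * ρ) w p)
        ((WithLp.toLp 2 p : VecPair d d') - WithLp.toLp 2 (x, y))
        = inner ℝ (gx p.1 p.2 + (2 * ρ) • (p.1 - w)) (p.1 - x)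
          + inner ℝ (-gy p.1 p.2) (p.2 - y) := WithLp.prod_inner_apply _ _
    rw [hin, ← neg_sub x p.1, inner_neg_right, ← neg_sub y p.2, inner_neg_neg]
    have h1 := hp.proxObj_add_inner_le w p.1 x hzt
    have h2 := hp.le_add_inner_sub_snd p.1 hzt hy
    have h3 := hp.proxObj_add_inner_le w zbar.1 p.1 hy
    have h4 := hp.le_add_inner_sub_snd x hbarY hzt
    have h5 := mul_nonneg hp.ρ_pos.le (sq_nonneg ‖x - p.1‖)
    have h6 := mul_nonneg hp.ρ_pos.le (sq_nonneg ‖p.1 - zbar.1‖)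
    have h7 := mul_nonneg hp.μy_pos.le (sq_nonneg ‖y - p.2‖)
    have h8 := mul_nonneg hp.μy_pos.le (sq_nonneg ‖p.2 - zbar.2‖)
    simp only [proxObj] at *
    linarith
  refine le_trans (le_of_eq ?_) (Finset.sum_le_sum hterm)
  rw [Finset.sum_add_distrib, Finset.sum_const, Finset.card_range, nsmul_eq_mul,
    Finset.sum_sub_distrib, ← inner_sum, ← inner_sum, hsum1, hsum2, inner_zero_right,
    inner_zero_right]
  ring

variable {Ξ : Type*} [MeasurableSpace Ξ] {D : Measure Ξ}
  {Gx : Vec d → Vec d' → Ξ → Vec d} {Gy : Vec d → Vec d' → Ξ → Vec d'} {σ : ℝ}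
  {Ω : Type*} [MeasurableSpace Ω] {Pr : Measure Ω} [IsProbabilityMeasure Pr]
  {ξ : ℕ → ℕ → Ω → Ξ}

/-- In expectation the noise term of one step is at most `7 η² σ²`: the inner product with the
vector determined by the earlier samples has mean zero. -/
theorem integral_ogdaNoise_le [IsProbabilityMeasure D]
    (hp : NCSCProblem f gx gy Y l μy L ρ μ xstar)
    (hs : StochasticGradient D gx gy Y Gx Gy σ) (hξ : ∀ k t, Measurable (ξ k t))
    (hξD : ∀ k t, Pr.map (ξ k t) = D) (hind : iIndepFun (fun p : ℕ × ℕ => ξ p.1 p.2) Pr)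
    {γ η : ℝ} (hγ : 0 ≤ γ) {k : ℕ} {w : Ω → Vec d × Vec d'}
    (hY : Y.Nonempty) (hw : Measurable[samplePast ξ k 0] w) (hwY : ∀ ω, (w ω).2 ∈ Y)
    (hw2 : MemLp (fun ω => (WithLp.toLp 2 (w ω) : VecPair d d')) 2 Pr)
    {z : ℕ → Ω → Vec d × Vec d'} (hz : z = fun t ω => (stageIter Y Gx Gy γ η ξ k w t ω).1)
    {N : ℕ → Ω → ℝ} (hN : N = fun t ω => ogdaNoise η (fun t => (WithLp.toLp 2 (z t ω) : VecPair d d'))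
      (fun t => gradOp gx gy γ (w ω).1 (z t ω))
      (fun t => gradNoise gx gy Gx Gy (z t ω) (ξ k t ω)) t) (t : ℕ) :
    Integrable (N t) Pr ∧ ∫ ω, N t ω ∂Pr ≤ 7 * η ^ 2 * σ ^ 2 := by
  have hzm : ∀ t, Measurable[samplePast ξ k t] (z t) := fun t => by
    rw [hz]; exact (measurable_stageIter hp hs hY hw t).1
  have hzY : ∀ t ω, (z t ω).2 ∈ Y := fun t ω => by
    rw [hz]; exact (stageIter_mem hp.isClosed hwY t ω).1
  have hz2 : ∀ t, MemLp (fun ω => (WithLp.toLp 2 (z t ω) : VecPair d d')) 2 Pr := fun t => by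
    rw [hz]; exact (memLp_stageIter hp hs hξ hξD hind hγ hY hw hwY hw2 t).1
  set Θ : ℕ → Ω → VecPair d d' := fun t ω => gradNoise gx gy Gx Gy (z t ω) (ξ k t ω) with hΘ
  set F : ℕ → Ω → VecPair d d' := fun t ω => gradOp gx gy γ (w ω).1 (z t ω) with hF
  have hΘ2 := fun t => hs.memLp_gradNoise hξ hξD hind (hzm t) (hzY t)
  have hF2 : ∀ t, MemLp (F t) 2 Pr := fun t => memLp_gradOp hp hs hγ
    (hw.mono (samplePast_le hξ _ _) le_rfl) ((hzm t).mono (samplePast_le hξ _ _) le_rfl) (hzY t)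
    hw2 (hz2 t)
  have hzm' : ∀ {s r : ℕ}, s ≤ r → Measurable[samplePast ξ k r] (z s) := fun h =>
    (hzm _).mono (samplePast_mono_right k h) le_rfl
  have hΘm : ∀ {s r : ℕ}, s + 1 ≤ r → Measurable[samplePast ξ k r] (Θ s) := fun h =>
    hs.measurable_gradNoise (hzm' (by omega)) (hzY _)
      ((measurable_sample_samplePast k _).mono (samplePast_mono_right k h) le_rfl)
  have hFm : ∀ {s r : ℕ}, s ≤ r → Measurable[samplePast ξ k r] (F s) := fun h =>
    hs.measurable_gradOp γ (hw.mono (samplePast_mono_right k (Nat.zero_le _)) le_rfl) (hzm' h)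
      (hzY _)
  set W : Ω → VecPair d d' := fun ω => (2 * η ^ 2) • (F (t + 1) ω - F t ω - Θ t ω)
    - η • ((WithLp.toLp 2 (z (t + 1) ω) : VecPair d d')
      - (WithLp.toLp 2 (z 0 ω) + η • ∑ s ∈ Finset.range t, Θ (s + 1) ω)) with hW
  have hWm : Measurable[samplePast ξ k (t + 1)] W := by
    have h1 : Measurable[samplePast ξ k (t + 1)] fun ω =>
        (2 * η ^ 2) • (F (t + 1) ω - F t ω - Θ t ω) :=
      (measurable_const_smul (2 * η ^ 2)).comp
        (((hFm le_rfl).sub (hFm (Nat.le_succ t))).sub (hΘm le_rfl))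
    have h2 : Measurable[samplePast ξ k (t + 1)] fun ω => ∑ s ∈ Finset.range t, Θ (s + 1) ω :=
      Finset.measurable_fun_sum _ fun s hs => hΘm (by have := Finset.mem_range.1 hs; omega)
    have h3 : Measurable[samplePast ξ k (t + 1)] fun ω =>
        η • ∑ s ∈ Finset.range t, Θ (s + 1) ω := (measurable_const_smul η).comp h2
    have h4 : ∀ {s : ℕ}, s ≤ t + 1 → Measurable[samplePast ξ k (t + 1)] fun ω =>
        (WithLp.toLp 2 (z s ω) : VecPair d d') := fun h =>
      (WithLp.measurable_toLp 2 _).comp (hzm' h)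
    have h5 : Measurable[samplePast ξ k (t + 1)] fun ω =>
        η • ((WithLp.toLp 2 (z (t + 1) ω) : VecPair d d')
          - (WithLp.toLp 2 (z 0 ω) + η • ∑ s ∈ Finset.range t, Θ (s + 1) ω)) :=
      (measurable_const_smul η).comp ((h4 le_rfl).sub ((h4 (Nat.zero_le _)).add h3))
    exact h1.sub h5
  have hW2 : MemLp W 2 Pr := by
    have h2 : MemLp (fun ω => ∑ s ∈ Finset.range t, Θ (s + 1) ω) 2 Pr :=
      memLp_finsetSum _ fun s _ => (hΘ2 (s + 1)).1
    have h3 : MemLp (fun ω => F (t + 1) ω - F t ω - Θ t ω) 2 Pr :=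
      ((hF2 (t + 1)).sub (hF2 t)).sub (hΘ2 t).1
    have h4 : MemLp (fun ω => η • ∑ s ∈ Finset.range t, Θ (s + 1) ω) 2 Pr := h2.const_smul η
    have h5 : MemLp (fun ω => (WithLp.toLp 2 (z (t + 1) ω) : VecPair d d')
        - (WithLp.toLp 2 (z 0 ω) + η • ∑ s ∈ Finset.range t, Θ (s + 1) ω)) 2 Pr :=
      (hz2 (t + 1)).sub ((hz2 0).add h4)
    have h6 := (h3.const_smul (2 * η ^ 2)).sub (h5.const_smul η)
    exact h6
  have hzero := hs.integral_inner_gradNoise hξ hξD hind (hzm (t + 1)) (hzY (t + 1)) hWm hW2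
  have hi1 := (hΘ2 t).1.integrable_norm_pow two_ne_zero
  have hi2 := (hΘ2 (t + 1)).1.integrable_norm_pow two_ne_zero
  have hi3 := integrable_inner_of_memLp (hΘ2 (t + 1)).1 hW2
  have hNt : N t = fun ω => 2 * η ^ 2 * ‖Θ t ω‖ ^ 2 + 3 / 2 * η ^ 2 * ‖Θ (t + 1) ω‖ ^ 2
      + inner ℝ (Θ (t + 1) ω) (W ω) := by
    rw [hN]; rfl
  rw [hNt]
  have hi12 := (hi1.const_mul (2 * η ^ 2)).add (hi2.const_mul (3 / 2 * η ^ 2))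
  refine ⟨hi12.add hi3, ?_⟩
  have e1 := integral_add hi12 hi3
  have e2 := integral_add (hi1.const_mul (2 * η ^ 2)) (hi2.const_mul (3 / 2 * η ^ 2))
  have e3 := integral_const_mul (μ := Pr) (2 * η ^ 2) (fun ω => ‖Θ t ω‖ ^ 2)
  have e4 := integral_const_mul (μ := Pr) (3 / 2 * η ^ 2) (fun ω => ‖Θ (t + 1) ω‖ ^ 2)
  simp only [Pi.add_apply] at e1 e2
  rw [e1, e2, e3, e4, hzero]
  have h1 := mul_le_mul_of_nonneg_left (hΘ2 t).2 (by positivity : 0 ≤ 2 * η ^ 2)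
  have h2 := mul_le_mul_of_nonneg_left (hΘ2 (t + 1)).2 (by positivity : 0 ≤ 3 / 2 * η ^ 2)
  linarith

/-- The guarantee for one stage with random starting point `w`. -/
theorem exists_stage_bound [IsProbabilityMeasure D]
    (hp : NCSCProblem f gx gy Y l μy L ρ μ xstar)
    (hs : StochasticGradient D gx gy Y Gx Gy σ) (hξ : ∀ k t, Measurable (ξ k t))
    (hξD : ∀ k t, Pr.map (ξ k t) = D) (hind : iIndepFun (fun p : ℕ × ℕ => ξ p.1 p.2) Pr)
    {η : ℝ} (hη : 0 < η) (hηl : 8 * (η * (l + 2 * ρ)) ^ 2 ≤ 1) {k T : ℕ} (hT : 0 < T)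
    {w out : Ω → Vec d × Vec d'} (hY : Y.Nonempty)
    (hw : Measurable[samplePast ξ k 0] w) (hwY : ∀ ω, (w ω).2 ∈ Y)
    (hw2 : MemLp (fun ω => (WithLp.toLp 2 (w ω) : VecPair d d')) 2 Pr)
    (hout : out = fun ω =>
      ogdaAvg Y (fun z t => stochOp Gx Gy (2 * ρ) (w ω).1 z (ξ k t ω)) η (w ω) T) :
    Measurable[samplePast ξ (k + 1) 0] out ∧ (∀ ω, (out ω).2 ∈ Y) ∧
      MemLp (fun ω => (WithLp.toLp 2 (out ω) : VecPair d d')) 2 Pr ∧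
      ∃ N : Ω → ℝ, Integrable N Pr ∧ ∫ ω, N ω ∂Pr ≤ 7 * η * σ ^ 2 ∧
        ∀ ω, ∀ x, ∀ y ∈ Y,
          proxObj f (2 * ρ) (w ω).1 (out ω).1 y - proxObj f (2 * ρ) (w ω).1 x (out ω).2
            ≤ (‖x - (w ω).1‖ ^ 2 + ‖y - (w ω).2‖ ^ 2) / (η * T) + N ω := by
  have hγ : 0 ≤ 2 * ρ := by linarith [hp.ρ_pos]
  set z : ℕ → Ω → Vec d × Vec d' := fun t ω => (stageIter Y Gx Gy (2 * ρ) η ξ k w t ω).1 with hz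
  have houtz : ∀ ω, out ω = (T : ℝ)⁻¹ • ∑ t ∈ Finset.range T, z (t + 1) ω := fun ω => by
    rw [hout, ← sum_Icc_one_eq_sum_range fun t => z t ω]; rfl
  have hzY : ∀ t ω, (z t ω).2 ∈ Y := fun t ω => (stageIter_mem hp.isClosed hwY t ω).1
  have hztY : ∀ t ω, (stageIter Y Gx Gy (2 * ρ) η ξ k w t ω).2.2 ∈ Y := fun t ω =>
    (stageIter_mem hp.isClosed hwY t ω).2
  set N : ℕ → Ω → ℝ := fun t ω => ogdaNoise η (fun t => (WithLp.toLp 2 (z t ω) : VecPair d d'))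
      (fun t => gradOp gx gy (2 * ρ) (w ω).1 (z t ω))
      (fun t => gradNoise gx gy Gx Gy (z t ω) (ξ k t ω)) t with hN
  have hNi := integral_ogdaNoise_le hp hs hξ hξD hind hγ hY hw hwY hw2 hz hN
  have hηT : 0 < η * T := by positivity
  refine ⟨?_, ?_, ?_, fun ω => (∑ t ∈ Finset.range T, N t ω) / (η * T), ?_, ?_, ?_⟩
  · rw [funext houtz]
    have h1 : Measurable[samplePast ξ (k + 1) 0] fun ω => ∑ t ∈ Finset.range T, z (t + 1) ω :=
      Finset.measurable_fun_sum _ fun t _ =>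
        (measurable_stageIter hp hs hY hw (t + 1)).1.mono (samplePast_le_succ k (t + 1)) le_rfl
    exact (measurable_const_smul (T : ℝ)⁻¹).comp h1
  · intro ω
    rw [houtz]
    exact snd_average_mem hp.convex hT fun t => hzY t ω
  · simp only [houtz, WithLp.toLp_smul, WithLp.toLp_sum]
    have h1 : MemLp (fun ω => ∑ t ∈ Finset.range T,
        (WithLp.toLp 2 (z (t + 1) ω) : VecPair d d')) 2 Pr :=
      memLp_finsetSum _ fun t _ =>
        (memLp_stageIter hp hs hξ hξD hind hγ hY hw hwY hw2 (t + 1)).1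
    exact h1.const_smul (T : ℝ)⁻¹
  · exact (integrable_finsetSum _ fun t _ => (hNi t).1).div_const _
  · rw [integral_div, integral_finsetSum _ fun t _ => (hNi t).1, div_le_iff₀ hηT]
    refine (Finset.sum_le_sum fun t _ => (hNi t).2).trans_eq ?_
    rw [Finset.sum_const, Finset.card_range, nsmul_eq_mul]
    ring
  · intro ω x y hy
    have havg := hp.proxObj_average_sub_le (w ω).1 hT (z := fun t => z t ω) (fun t => hzY t ω)
      (houtz ω) x hy
    have hG : ∀ t, (η • (gradOp gx gy (2 * ρ) (w ω).1 (z t ω)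
        + gradNoise gx gy Gx Gy (z t ω) (ξ k t ω)) : VecPair d d')
        = WithLp.toLp 2 (η • stochOp Gx Gy (2 * ρ) (w ω).1 (z t ω) (ξ k t ω)) := fun t => by
      rw [WithLp.toLp_smul, toLp_stochOp (gx := gx) (gy := gy)]
    have hreg := ogda_regret (l := l + 2 * ρ) hη hηl
      (S := {u : VecPair d d' | u.snd ∈ Y})
      (z := fun t => (WithLp.toLp 2 (z t ω) : VecPair d d'))
      (zt := fun t => (WithLp.toLp 2 (stageIter Y Gx Gy (2 * ρ) η ξ k w t ω).2 : VecPair d d'))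
      (F := fun t => gradOp gx gy (2 * ρ) (w ω).1 (z t ω))
      (Θ := fun t => gradNoise gx gy Gx Gy (z t ω) (ξ k t ω)) rfl
      (fun t => hzY t ω) (fun t => hztY t ω)
      (fun t u hu => by
        rw [hG]
        exact proxMap_inner_nonneg hp.isClosed hp.convex _ _ (w := u.ofLp) hu)
      (fun t u hu => by
        rw [hG]
        exact proxMap_inner_nonneg hp.isClosed hp.convex _ _ (w := u.ofLp) hu)
      (fun t => by
        have := hp.norm_gradOp_sub_le hγ (w ω).1 (w ω).1 (hzY (t + 1) ω) (hzY t ω)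
        rwa [sub_self, norm_zero, mul_zero, add_zero] at this)
      (u := WithLp.toLp 2 (x, y)) hy T
    have hnorm : ‖(WithLp.toLp 2 (x, y) : VecPair d d') - WithLp.toLp 2 (z 0 ω)‖ ^ 2
        = ‖x - (w ω).1‖ ^ 2 + ‖y - (w ω).2‖ ^ 2 := WithLp.prod_norm_sq_eq_of_L2 _
    rw [hnorm] at hreg
    have := mul_le_mul_of_nonneg_left havg hη.le
    rw [← add_div, le_div_iff₀ hηT]
    linarith

end StageBound

/-! ### Convergence of the stages -/

section Convergence

variable {d d' : ℕ} {f : Vec d → Vec d' → ℝ} {gx : Vec d → Vec d' → Vec d}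
  {gy : Vec d → Vec d' → Vec d'} {Y : Set (Vec d')} {l μy L ρ μ : ℝ} {xstar : Vec d}

namespace NCSCProblem

theorem cConst_pos (hp : NCSCProblem f gx gy Y l μy L ρ μ xstar) : 0 < cConst L ρ := by
  have := hp.Lhat_pos
  have := hp.ρ_pos
  unfold cConst
  linarith

theorem rate_pos (hp : NCSCProblem f gx gy Y l μy L ρ μ xstar) : 0 < rate L ρ μ := by
  have := hp.cConst_pos
  have := hp.μ_pos
  unfold rate
  positivity

theorem rate_le_one (hp : NCSCProblem f gx gy Y l μy L ρ μ xstar) : rate L ρ μ ≤ 1 := by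
  have := hp.cConst_pos
  have := hp.μ_pos
  unfold rate
  rw [div_le_one (by positivity)]
  linarith

theorem one_sub_rate (hp : NCSCProblem f gx gy Y l μy L ρ μ xstar) :
    cConst L ρ / (cConst L ρ + 2 * μ) = 1 - rate L ρ μ := by
  have := hp.cConst_pos
  have := hp.μ_pos
  unfold rate
  field_simp
  ring

/-- As an infimum of continuous functions the envelope is upper semicontinuous, hence measurable.
The restriction to `ℝᵈ × Y` is needed because `f` is unconstrained elsewhere. -/
theorem upperSemicontinuous_proxEnvelope (hp : NCSCProblem f gx gy Y l μy L ρ μ xstar) :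
    UpperSemicontinuous fun z : {z : Vec d × Vec d' // z.2 ∈ Y} =>
      proxEnvelope f ρ z.1.1 z.1.2 := by
  refine upperSemicontinuous_ciInf (f := fun (x : Vec d) (z : {z : Vec d × Vec d' // z.2 ∈ Y}) =>
    proxObj f (2 * ρ) z.1.1 x z.1.2) (fun z => ?_) fun x => Continuous.upperSemicontinuous ?_
  · refine ⟨proxEnvelope f ρ z.1.1 z.1.2, ?_⟩
    rintro _ ⟨x, rfl⟩
    exact hp.proxEnvelope_le _ _ z.2
  · have h1 : Continuous fun z : {z : Vec d × Vec d' // z.2 ∈ Y} => f x z.1.2 :=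
      (hp.continuousOn_snd x).comp_continuous (by fun_prop) fun z => z.2
    have h2 : Continuous fun z : {z : Vec d × Vec d' // z.2 ∈ Y} =>
        2 * ρ / 2 * ‖x - z.1.1‖ ^ 2 := by fun_prop
    exact h1.add h2

theorem measurable_lyapunov (hp : NCSCProblem f gx gy Y l μy L ρ μ xstar) {Ω : Type*}
    [MeasurableSpace Ω] {z : Ω → Vec d × Vec d'} (hz : Measurable z) (hzY : ∀ ω, (z ω).2 ∈ Y) :
    Measurable fun ω => lyapunov f Y L ρ xstar (z ω) := by
  have h1 : Measurable fun ω => primal f Y (z ω).1 :=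
    hp.primal_differentiable.continuous.measurable.comp hz.fst
  have h2 : Measurable fun ω => proxEnvelope f ρ (z ω).1 (z ω).2 :=
    hp.upperSemicontinuous_proxEnvelope.measurable.comp (hz.subtype_mk (h := hzY))
  have h3 : (fun ω => lyapunov f Y L ρ xstar (z ω)) = fun ω =>
      primal f Y (z ω).1 - primal f Y xstar + 8 * Lhat L ρ / (53 * cConst L ρ)
        * (primal f Y (z ω).1 - proxEnvelope f ρ (z ω).1 (z ω).2) := by
    funext ω
    rw [lyapunov, hp.dualityGap_proxObj _ _ (hzY ω), sub_self, norm_zero]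
    ring
  rw [h3]
  exact (h1.sub_const _).add ((h1.sub h2).const_mul _)

end NCSCProblem

theorem epochLength_pos {η₀ : ℝ} (hη₀ : 0 < η₀) (hm : 0 < min ρ μy) (k : ℕ) :
    0 < epochLength L ρ μ μy η₀ k :=
  Nat.ceil_pos.2 (by positivity)

theorem le_stepSize_mul_epochLength {η₀ : ℝ} (hη₀ : 0 < η₀) (hm : 0 < min ρ μy) (k : ℕ) :
    212 / min ρ μy ≤ stepSize L ρ μ η₀ k * epochLength L ρ μ μy η₀ k := by
  have h : 212 / (η₀ * min ρ μy) * Real.exp (((k : ℝ) - 1) * rate L ρ μ)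
      ≤ epochLength L ρ μ μy η₀ k := Nat.le_ceil _
  have hs : 0 < stepSize L ρ μ η₀ k := mul_pos hη₀ (Real.exp_pos _)
  refine le_trans (le_of_eq ?_) (mul_le_mul_of_nonneg_left h hs.le)
  rw [stepSize, Real.exp_neg]
  field_simp

theorem stepSize_mul_sq_le {η₀ : ℝ} (hη₀ : 0 < η₀) (hρ : 0 < ρ) (hl : ρ ≤ l)
    (hη₀l : η₀ ≤ 1 / (2 * √2 * (l + 2 * ρ))) (hr : 0 ≤ rate L ρ μ) (k : ℕ) :
    8 * (stepSize L ρ μ η₀ (k + 1) * (l + 2 * ρ)) ^ 2 ≤ 1 := by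
  have h1 : stepSize L ρ μ η₀ (k + 1) ≤ η₀ := by
    refine mul_le_of_le_one_right hη₀.le (Real.exp_le_one_iff.2 ?_)
    push_cast
    rw [add_sub_cancel_right, neg_nonpos]
    positivity
  have hl' : 0 < l + 2 * ρ := by linarith
  have hs : 0 < stepSize L ρ μ η₀ (k + 1) := mul_pos hη₀ (Real.exp_pos _)
  have h2 : stepSize L ρ μ η₀ (k + 1) * (l + 2 * ρ) ≤ 1 / (2 * √2) := by
    calc stepSize L ρ μ η₀ (k + 1) * (l + 2 * ρ)
        ≤ 1 / (2 * √2 * (l + 2 * ρ)) * (l + 2 * ρ) := by gcongr; exact h1.trans hη₀l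
      _ = 1 / (2 * √2) := by field_simp
  have h3 := pow_le_pow_left₀ (by positivity) h2 2
  rw [div_pow, mul_pow 2, Real.sq_sqrt (by norm_num)] at h3
  linarith

variable {Ξ : Type*} [MeasurableSpace Ξ] {D : Measure Ξ}
  {Gx : Vec d → Vec d' → Ξ → Vec d} {Gy : Vec d → Vec d' → Ξ → Vec d'} {σ : ℝ}
  {Ω : Type*} [MeasurableSpace Ω] {Pr : Measure Ω} [IsProbabilityMeasure Pr]
  {ξ : ℕ → ℕ → Ω → Ξ}

/-- The linear rate of the Lyapunov function in expectation.  The induction also carries the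
measurability of the outputs with respect to the past samples and their square integrability. -/
theorem integral_lyapunov_pes_le [IsProbabilityMeasure D]
    (hp : NCSCProblem f gx gy Y l μy L ρ μ xstar)
    (hs : StochasticGradient D gx gy Y Gx Gy σ) (hξ : ∀ k t, Measurable (ξ k t))
    (hξD : ∀ k t, Pr.map (ξ k t) = D) (hind : iIndepFun (fun p : ℕ × ℕ => ξ p.1 p.2) Pr)
    {η₀ : ℝ} (hη₀ : 0 < η₀) (hη₀l : η₀ ≤ 1 / (2 * √2 * (l + 2 * ρ)))
    {z₀ : Vec d × Vec d'} (hz₀ : z₀.2 ∈ Y) {z : ℕ → Ω → Vec d × Vec d'}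
    (hz : z = fun k ω => pes Y Gx Gy (2 * ρ) (stepSize L ρ μ η₀) (epochLength L ρ μ μy η₀)
      (fun k t => ξ k t ω) z₀ k) (K : ℕ) :
    Measurable[samplePast ξ (K + 1) 0] (z K) ∧ (∀ ω, (z K ω).2 ∈ Y) ∧
      MemLp (fun ω => (WithLp.toLp 2 (z K ω) : VecPair d d')) 2 Pr ∧
      Integrable (fun ω => lyapunov f Y L ρ xstar (z K ω)) Pr ∧
      ∫ ω, lyapunov f Y L ρ xstar (z K ω) ∂Pr ≤ Real.exp (-(K * rate L ρ μ)) *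
        (lyapunov f Y L ρ xstar z₀ + K * (η₀ * Real.exp (rate L ρ μ)
          * (56 * Lhat L ρ * σ ^ 2 / (cConst L ρ + 2 * μ)))) := by
  have hm : 0 < min ρ μy := lt_min hp.ρ_pos hp.μy_pos
  have hc := hp.cConst_pos
  have hμ := hp.μ_pos
  have hL := hp.Lhat_pos
  induction K with
  | zero =>
    have h0 : z 0 = fun _ => z₀ := by rw [hz]; rfl
    rw [h0]
    refine ⟨measurable_const, fun _ => hz₀, memLp_const _, integrable_const _, ?_⟩
    simp
  | succ K ih =>
    obtain ⟨hw, hwY, hw2, hint, hle⟩ := ih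
    have hT := epochLength_pos (L := L) (μ := μ) hη₀ hm (K + 1)
    have hη : 0 < stepSize L ρ μ η₀ (K + 1) := mul_pos hη₀ (Real.exp_pos _)
    obtain ⟨hm', hY', h2', N, hN, hNle, hbound⟩ := exists_stage_bound hp hs hξ hξD hind hη
      (stepSize_mul_sq_le hη₀ hp.ρ_pos hp.ρ_le hη₀l hp.rate_pos.le K) hT (out := z (K + 1))
      ⟨_, hz₀⟩ hw hwY hw2 (by rw [hz]; rfl)
    have hstep : ∀ ω, lyapunov f Y L ρ xstar (z (K + 1) ω)
        ≤ (1 - rate L ρ μ) * lyapunov f Y L ρ xstar (z K ω)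
          + 8 * Lhat L ρ / (cConst L ρ + 2 * μ) * N ω := by
      intro ω
      have h1 := hp.lyapunov_step (hwY ω) (hY' ω)
        (le_stepSize_mul_epochLength (L := L) (μ := μ) hη₀ hm (K + 1)) (hbound ω)
      rw [← hp.one_sub_rate]
      refine le_of_mul_le_mul_left (h1.trans_eq ?_) (by positivity : 0 < cConst L ρ + 2 * μ)
      field_simp
    have hrhs := (hint.const_mul (1 - rate L ρ μ)).add
      (hN.const_mul (8 * Lhat L ρ / (cConst L ρ + 2 * μ)))
    have hint' : Integrable (fun ω => lyapunov f Y L ρ xstar (z (K + 1) ω)) Pr := by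
      refine hrhs.mono' (hp.measurable_lyapunov (hm'.mono (samplePast_le hξ _ _) le_rfl)
        hY').aestronglyMeasurable (Filter.Eventually.of_forall fun ω => ?_)
      rw [Real.norm_of_nonneg (hp.lyapunov_nonneg (hY' ω))]
      exact hstep ω
    refine ⟨hm', hY', h2', hint', ?_⟩
    have h1 := integral_mono hint' hrhs hstep
    have h2 := integral_add (hint.const_mul (1 - rate L ρ μ))
      (hN.const_mul (8 * Lhat L ρ / (cConst L ρ + 2 * μ)))
    simp only [Pi.add_apply] at h1
    rw [h2, integral_const_mul, integral_const_mul] at h1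
    have h3 : 0 ≤ ∫ ω, lyapunov f Y L ρ xstar (z K ω) ∂Pr :=
      integral_nonneg fun ω => hp.lyapunov_nonneg (hwY ω)
    have h4 : 1 - rate L ρ μ ≤ Real.exp (-rate L ρ μ) := by
      linarith [Real.add_one_le_exp (-rate L ρ μ)]
    have h5 := (mul_le_mul_of_nonneg_right h4 h3).trans
      (mul_le_mul_of_nonneg_left hle (Real.exp_pos (-rate L ρ μ)).le)
    have h6 := mul_le_mul_of_nonneg_left hNle
      (by positivity : 0 ≤ 8 * Lhat L ρ / (cConst L ρ + 2 * μ))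
    refine h1.trans ((add_le_add h5 h6).trans_eq ?_)
    have e1 : Real.exp (-(((K + 1 : ℕ) : ℝ) * rate L ρ μ))
        = Real.exp (-rate L ρ μ) * Real.exp (-(K * rate L ρ μ)) := by
      rw [← Real.exp_add]; push_cast; ring_nf
    have e2 : stepSize L ρ μ η₀ (K + 1) = η₀ * Real.exp (-(K * rate L ρ μ)) := by
      rw [stepSize]; push_cast; rw [add_sub_cancel_right]
    have e3 : Real.exp (-rate L ρ μ) * Real.exp (rate L ρ μ) = 1 := by
      rw [← Real.exp_add, neg_add_cancel, Real.exp_zero]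
    rw [e1, e2]
    push_cast
    linear_combination (-(Real.exp (-(K * rate L ρ μ)) * η₀
      * (56 * Lhat L ρ * σ ^ 2 / (cConst L ρ + 2 * μ)))) * e3

theorem le_exp_of_log_le {x y : ℝ} (h : Real.log x ≤ y) : x ≤ Real.exp y := by
  rcases le_or_gt x 0 with hx | hx
  · exact hx.trans (Real.exp_pos y).le
  · exact (Real.log_le_iff_le_exp hx).1 h

/-- With enough stages, the bias is at most `8 / 31 ε` and the noise at most `e 56 / 208 ε`. -/
theorem exp_mul_le_of_enoughStages (hp : NCSCProblem f gx gy Y l μy L ρ μ xstar)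
    {η₀ ε₀ ε Λ : ℝ} (hε : 0 < ε) (hΛ : Λ ≤ 32 / 31 * ε₀) {K : ℕ}
    (hK : EnoughStages L ρ μ η₀ σ ε₀ ε K) :
    Real.exp (-(K * rate L ρ μ)) *
        (Λ + K * (η₀ * Real.exp (rate L ρ μ)
          * (56 * Lhat L ρ * σ ^ 2 / (cConst L ρ + 2 * μ)))) ≤ ε := by
  have hr := hp.rate_pos
  have hc := hp.cConst_pos
  have hμ := hp.μ_pos
  have hinv : (cConst L ρ + 2 * μ) / (2 * μ) = (rate L ρ μ)⁻¹ := by rw [rate, inv_div]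
  unfold EnoughStages at hK
  rw [hinv, max_le_iff, inv_mul_le_iff₀ hr, inv_mul_le_iff₀ hr, mul_comm (rate L ρ μ)] at hK
  have h1 := le_exp_of_log_le hK.1
  have h2 := le_exp_of_log_le hK.2
  set X := Real.exp (K * rate L ρ μ) with hX
  have hX0 : 0 < X := Real.exp_pos _
  rw [Real.exp_neg, inv_mul_le_iff₀ hX0]
  rw [div_le_iff₀ hε] at h1
  have h3 : 208 * (K * η₀ * (Lhat L ρ * σ ^ 2 / (cConst L ρ + 2 * μ))) ≤ X * ε := by
    rw [div_le_iff₀ (by positivity)] at h2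
    have : 208 * (K * η₀ * (Lhat L ρ * σ ^ 2 / (cConst L ρ + 2 * μ)))
        = 208 * η₀ * Lhat L ρ * K * σ ^ 2 / (cConst L ρ + 2 * μ) := by ring
    rw [this, div_le_iff₀ (by positivity)]
    linarith
  have h4 : Real.exp (rate L ρ μ) ≤ 2.72 :=
    (Real.exp_le_exp.2 hp.rate_le_one).trans (Real.exp_one_lt_d9.le.trans (by norm_num))
  have h5 : K * (η₀ * Real.exp (rate L ρ μ) * (56 * Lhat L ρ * σ ^ 2 / (cConst L ρ + 2 * μ)))
      = 56 / 208 * Real.exp (rate L ρ μ)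
        * (208 * (K * η₀ * (Lhat L ρ * σ ^ 2 / (cConst L ρ + 2 * μ)))) := by ring
  rw [h5]
  have h6 := mul_le_mul_of_nonneg_left h3
    (by positivity : 0 ≤ 56 / 208 * Real.exp (rate L ρ μ))
  have h7 : 56 / 208 * Real.exp (rate L ρ μ) * (X * ε) ≤ 56 / 208 * 2.72 * (X * ε) := by gcongr
  have h8 : 0 < X * ε := by positivity
  norm_num at h7
  linarith

end Convergence

/-! ### The total number of iterations -/

section Complexity

theorem sum_range_exp_le {r : ℝ} (hr : 0 < r) (K : ℕ) :
    ∑ j ∈ Finset.range K, Real.exp (j * r) ≤ Real.exp (K * r) / r := by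
  induction K with
  | zero => simpa using hr.le
  | succ K ih =>
    rw [Finset.sum_range_succ]
    have h1 : Real.exp (((K + 1 : ℕ) : ℝ) * r) = Real.exp (K * r) * Real.exp r := by
      rw [← Real.exp_add]; push_cast; ring_nf
    rw [h1, le_div_iff₀ hr]
    rw [le_div_iff₀ hr] at ih
    nlinarith [Real.add_one_le_exp r, Real.exp_pos (K * r)]

/-- The growth `e^u ≤ a u` forces `u` to be logarithmic in `a`. -/
theorem le_log_of_exp_le_mul {u M : ℝ} (hM : 0 ≤ M) (h : Real.exp u ≤ 52 * M * u) :
    u ≤ 16 * Real.log (2 + M) := by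
  have h1 : Real.exp u = Real.exp (u / 2) * Real.exp (u / 2) := by
    rw [← Real.exp_add]; ring_nf
  have h2 := Real.add_one_le_exp (u / 2)
  have h3 : Real.exp (u / 2) ≤ 104 * M := by
    refine le_of_mul_le_mul_left ?_ (Real.exp_pos (u / 2))
    rw [← h1]
    nlinarith
  have h4 : 104 * M ≤ (2 + M) ^ 8 := by
    have h5 : (2 : ℝ) ^ 7 ≤ (2 + M) ^ 7 := pow_le_pow_left₀ (by norm_num) (by linarith) 7
    calc 104 * M ≤ 2 ^ 7 * (2 + M) := by linarith
      _ ≤ (2 + M) ^ 7 * (2 + M) := by gcongr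
      _ = (2 + M) ^ 8 := by ring
  have h5 := Real.log_le_log (Real.exp_pos _) (h3.trans h4)
  rw [Real.log_exp, Real.log_pow] at h5
  push_cast at h5
  linarith

variable {d d' : ℕ} {f : Vec d → Vec d' → ℝ} {gx : Vec d → Vec d' → Vec d}
  {gy : Vec d → Vec d' → Vec d'} {Y : Set (Vec d')} {l μy L ρ μ : ℝ} {xstar : Vec d}

theorem exists_isLeast_enoughStages (hp : NCSCProblem f gx gy Y l μy L ρ μ xstar)
    {η₀ σ ε₀ ε : ℝ} (hη₀ : 0 < η₀) (hε : 0 < ε) :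
    ∃ K : ℕ, IsLeast {K' : ℕ | EnoughStages L ρ μ η₀ σ ε₀ ε K'} K := by
  have hne : {K' : ℕ | EnoughStages L ρ μ η₀ σ ε₀ ε K'}.Nonempty := by
    have hr := hp.rate_pos
    have hc := hp.cConst_pos
    have hμ := hp.μ_pos
    have hL := hp.Lhat_pos
    set B := (cConst L ρ + 2 * μ) / (2 * μ) with hB
    set b := 208 * η₀ * Lhat L ρ * σ ^ 2 / ((cConst L ρ + 2 * μ) * ε) with hb
    have hB0 : 0 < B := by positivity
    have hb0 : 0 ≤ b := by positivity
    -- with `log x ≤ 2 √x`, the second condition holds as soon as `K ≥ 4 B² b`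
    obtain ⟨K, hK⟩ := exists_nat_ge (max (B * Real.log (4 * ε₀ / ε)) (4 * B ^ 2 * b))
    refine ⟨K, max_le ((le_max_left _ _).trans hK) ?_⟩
    have hK2 := (le_max_right _ _).trans hK
    have harg : 208 * η₀ * Lhat L ρ * K * σ ^ 2 / ((cConst L ρ + 2 * μ) * ε) = b * K := by
      rw [hb]; ring
    rw [harg]
    have h1 : Real.log (b * K) ≤ 2 * √(b * K) := by
      have h2 := Real.log_le_self (Real.sqrt_nonneg (b * K))
      rw [Real.log_sqrt (by positivity)] at h2
      linarith
    have h2 : 2 * B * √(b * K) ≤ K := by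
      refine abs_le_of_sq_le_sq' ?_ (Nat.cast_nonneg K) |>.2
      rw [mul_pow, Real.sq_sqrt (by positivity)]
      nlinarith [mul_le_mul_of_nonneg_right hK2 (Nat.cast_nonneg (α := ℝ) K)]
    nlinarith
  exact ⟨_, Nat.sInf_mem hne, fun K' hK' => Nat.sInf_le hK'⟩

/-- The epoch lengths grow geometrically, so that their sum is governed by the last one. -/
theorem sum_epochLength_le (hp : NCSCProblem f gx gy Y l μy L ρ μ xstar) {η₀ : ℝ} (hη₀ : 0 < η₀)
    (hη₀m : η₀ * min ρ μy ≤ 212) (K : ℕ) :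
    ((∑ k ∈ Finset.Icc 1 (K + 1), epochLength L ρ μ μy η₀ k : ℕ) : ℝ)
      ≤ 6 * (212 / (η₀ * min ρ μy)) * Real.exp (K * rate L ρ μ) / rate L ρ μ := by
  have hr := hp.rate_pos
  have hm : 0 < min ρ μy := lt_min hp.ρ_pos hp.μy_pos
  set A := 212 / (η₀ * min ρ μy) with hA
  have hA1 : 1 ≤ A := by rwa [hA, one_le_div (by positivity)]
  have hterm : ∀ j ∈ Finset.range (K + 1),
      (epochLength L ρ μ μy η₀ (j + 1) : ℝ) ≤ 2 * A * Real.exp (j * rate L ρ μ) := by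
    intro j _
    have h1 : 1 ≤ A * Real.exp (j * rate L ρ μ) :=
      one_le_mul_of_one_le_of_one_le hA1 (Real.one_le_exp (by positivity))
    have h2 := Nat.ceil_lt_add_one (zero_le_one.trans h1)
    have h3 : epochLength L ρ μ μy η₀ (j + 1) = ⌈A * Real.exp (j * rate L ρ μ)⌉₊ := by
      rw [epochLength]; push_cast; rw [add_sub_cancel_right]
    rw [h3]
    linarith
  have hexp : Real.exp (rate L ρ μ) ≤ 3 :=
    (Real.exp_le_exp.2 hp.rate_le_one).trans (Real.exp_one_lt_d9.le.trans (by norm_num))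
  have hlast : Real.exp (((K + 1 : ℕ) : ℝ) * rate L ρ μ)
      ≤ 3 * Real.exp (K * rate L ρ μ) := by
    have : Real.exp (((K + 1 : ℕ) : ℝ) * rate L ρ μ)
        = Real.exp (rate L ρ μ) * Real.exp (K * rate L ρ μ) := by
      rw [← Real.exp_add]; push_cast; ring_nf
    rw [this]
    gcongr
  rw [sum_Icc_one_eq_sum_range, Nat.cast_sum]
  calc ∑ j ∈ Finset.range (K + 1), (epochLength L ρ μ μy η₀ (j + 1) : ℝ)
      ≤ ∑ j ∈ Finset.range (K + 1), 2 * A * Real.exp (j * rate L ρ μ) := Finset.sum_le_sum hterm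
    _ = 2 * A * ∑ j ∈ Finset.range (K + 1), Real.exp (j * rate L ρ μ) := by rw [Finset.mul_sum]
    _ ≤ 2 * A * (Real.exp (((K + 1 : ℕ) : ℝ) * rate L ρ μ) / rate L ρ μ) := by
      gcongr; exact sum_range_exp_le hr (K + 1)
    _ ≤ 2 * A * (3 * Real.exp (K * rate L ρ μ) / rate L ρ μ) := by gcongr
    _ = _ := by ring

theorem inv_rate_le (hp : NCSCProblem f gx gy Y l μy L ρ μ xstar) :
    (rate L ρ μ)⁻¹ ≤ 9 * ((L + ρ) / μ) := by
  have hμ := hp.μ_pos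
  have := hp.ρ_pos
  have := hp.L_nonneg
  have := hp.μ_le
  rw [rate, inv_div, ← mul_div_assoc, div_le_div_iff₀ (by positivity) hμ]
  have : cConst L ρ + 2 * μ ≤ 18 * (L + ρ) := by
    unfold cConst Lhat
    linarith
  nlinarith

/-- The total number of iterations for the least number of stages. -/
theorem sum_epochLength_le_complexityBound (hp : NCSCProblem f gx gy Y l μy L ρ μ xstar)
    {η₀ σ ε₀ ε : ℝ} (hη₀ : η₀ = 1 / (2 * √2 * (l + 2 * ρ))) (hσ : 0 < σ) (hε₀ : 0 ≤ ε₀)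
    (hε : 0 < ε) {K : ℕ} (hK : IsLeast {K' : ℕ | EnoughStages L ρ μ η₀ σ ε₀ ε K'} K) :
    ((∑ k ∈ Finset.Icc 1 K, epochLength L ρ μ μy η₀ k : ℕ) : ℝ)
      ≤ 40000000 * complexityBound l μy L ρ μ σ ε₀ ε
        * Real.log (2 + complexityBound l μy L ρ μ σ ε₀ ε) := by
  have hr := hp.rate_pos
  have hc := hp.cConst_pos
  have hμ := hp.μ_pos
  have hρ := hp.ρ_pos
  have hL := hp.L_nonneg
  have hL' := hp.Lhat_pos
  have hl := hp.ρ_le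
  have hm : 0 < min ρ μy := lt_min hp.ρ_pos hp.μy_pos
  have hmρ : min ρ μy ≤ ρ := min_le_left _ _
  have hl0 : 0 < l := hρ.trans_le hl
  have hLρ : 0 < L + ρ := by linarith
  have hrinv := inv_rate_le hp
  have hsqrt1 : (1.4 : ℝ) ≤ √2 := Real.le_sqrt_of_sq_le (by norm_num)
  have hsqrt2 : √2 ≤ 1.5 := (Real.sqrt_le_left (by norm_num)).2 (by norm_num)
  have hη₀0 : 0 < η₀ := by rw [hη₀]; positivity
  have hη₀inv : η₀⁻¹ ≤ 9 * l := by
    rw [hη₀, one_div, inv_inv]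
    nlinarith
  have hη₀m : η₀ ≤ 1 / (8 * min ρ μy) := by
    rw [hη₀]
    refine one_div_le_one_div_of_le (by positivity) ?_
    nlinarith
  set M₁ := l * (L + ρ) * ε₀ / (μ * min ρ μy * ε) with hM₁
  set M₂ := (L + ρ) ^ 2 * σ ^ 2 / (μ ^ 2 * min ρ μy * ε) with hM₂
  have hM₁0 : 0 ≤ M₁ := by positivity
  have hM₂0 : 0 < M₂ := by positivity
  have hM : complexityBound l μy L ρ μ σ ε₀ ε = max M₁ M₂ := rfl
  rw [hM]
  set M := max M₁ M₂
  have hM1 : M₁ ≤ M := le_max_left _ _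
  have hM2 : M₂ ≤ M := le_max_right _ _
  have hM0 : 0 < M := hM₂0.trans_le hM2
  have hlog : 1 / 2 ≤ Real.log (2 + M) := by
    have h1 := Real.log_two_gt_d9
    have h2 : Real.log 2 ≤ Real.log (2 + M) := Real.log_le_log (by norm_num) (by linarith)
    linarith
  cases K with
  | zero =>
    simp only [Finset.Icc_eq_empty_of_lt zero_lt_one, Finset.sum_empty, Nat.cast_zero]
    positivity
  | succ K =>
    have hnot : ¬ EnoughStages L ρ μ η₀ σ ε₀ ε K := fun h =>
      absurd (hK.2 h) (Nat.not_succ_le_self K)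
    have hsum := sum_epochLength_le hp hη₀0 (by
      have := mul_le_mul_of_nonneg_right hη₀m hm.le
      have e : 1 / (8 * min ρ μy) * min ρ μy = 1 / 8 := by field_simp
      linarith) K
    refine hsum.trans ?_
    have hinv : (cConst L ρ + 2 * μ) / (2 * μ) = (rate L ρ μ)⁻¹ := by rw [rate, inv_div]
    unfold EnoughStages at hnot
    rw [hinv, not_le, lt_max_iff, lt_inv_mul_iff₀ hr, lt_inv_mul_iff₀ hr,
      mul_comm (rate L ρ μ)] at hnot
    -- `log x > 0` excludes the junk value of `log` at `0`
    have hexp_le : ∀ {x : ℝ}, 0 ≤ x → K * rate L ρ μ < Real.log x →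
        Real.exp (K * rate L ρ μ) ≤ x := by
      intro x hx h
      rcases hx.eq_or_lt with rfl | hx
      · rw [Real.log_zero] at h
        exact absurd h (not_lt.2 (by positivity))
      · exact ((Real.lt_log_iff_exp_lt hx).1 h).le
    rcases hnot with hnot | hnot
    · have h1 := hexp_le (by positivity) hnot
      calc 6 * (212 / (η₀ * min ρ μy)) * Real.exp (K * rate L ρ μ) / rate L ρ μ
          = 1272 / min ρ μy * η₀⁻¹ * Real.exp (K * rate L ρ μ) * (rate L ρ μ)⁻¹ := by
            field_simp; ring
        _ ≤ 1272 / min ρ μy * (9 * l) * (4 * ε₀ / ε) * (9 * ((L + ρ) / μ)) := by gcongr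
        _ = 412128 * M₁ := by rw [hM₁]; field_simp; ring
        _ ≤ 412128 * M := by gcongr
        _ ≤ 40000000 * M * Real.log (2 + M) := by nlinarith
    · have h1 := hexp_le (by positivity) hnot
      set u := K * rate L ρ μ with hu
      have hu0 : 0 ≤ u := by positivity
      have hKu : (K : ℝ) = u * (rate L ρ μ)⁻¹ := by rw [hu]; field_simp
      have hLhat : Lhat L ρ ≤ 2 * (L + ρ) := by unfold Lhat; linarith
      have hrc : rate L ρ μ * (cConst L ρ + 2 * μ) = 2 * μ := by
        rw [rate]; field_simp
      have h2 : 208 * η₀ * Lhat L ρ * K * σ ^ 2 / ((cConst L ρ + 2 * μ) * ε)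
          = 104 * η₀ * Lhat L ρ * σ ^ 2 * u / (μ * ε) := by
        rw [hKu]
        have : (cConst L ρ + 2 * μ) = 2 * μ * (rate L ρ μ)⁻¹ :=
          by
          rw [← div_eq_mul_inv, eq_div_iff hr.ne', mul_comm, hrc]
        rw [this]
        field_simp
        ring
      rw [h2] at h1
      have h3 : Real.exp u ≤ 52 * M₂ * u := by
        refine h1.trans ?_
        calc 104 * η₀ * Lhat L ρ * σ ^ 2 * u / (μ * ε)
            ≤ 104 * (1 / (8 * min ρ μy)) * (2 * (L + ρ)) * σ ^ 2 * u / (μ * ε) := by gcongr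
          _ = 26 * ((L + ρ) * σ ^ 2 * u / (min ρ μy * μ ^ 2 * ε)) * μ := by
            field_simp; ring
          _ ≤ 26 * ((L + ρ) * σ ^ 2 * u / (min ρ μy * μ ^ 2 * ε)) * (2 * (L + ρ)) := by
            gcongr
            linarith [hp.μ_le]
          _ = 52 * M₂ * u := by rw [hM₂]; field_simp; ring
      have h4 := le_log_of_exp_le_mul hM₂0.le h3
      have h5 : Real.log (2 + M₂) ≤ Real.log (2 + M) :=
        Real.log_le_log (by linarith) (by linarith)
      calc 6 * (212 / (η₀ * min ρ μy)) * Real.exp u / rate L ρ μ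
          ≤ 6 * (212 / (η₀ * min ρ μy)) * (104 * η₀ * Lhat L ρ * σ ^ 2 * u / (μ * ε))
              / rate L ρ μ := by gcongr
        _ = 132288 / min ρ μy * Lhat L ρ * σ ^ 2 * u / (μ * ε) * (rate L ρ μ)⁻¹ := by
            field_simp; ring
        _ ≤ 132288 / min ρ μy * (2 * (L + ρ)) * σ ^ 2 * (16 * Real.log (2 + M)) / (μ * ε)
              * (9 * ((L + ρ) / μ)) := by
            gcongr
            linarith
        _ = 38098944 * M₂ * Real.log (2 + M) := by rw [hM₂]; field_simp; ring
        _ ≤ 40000000 * M * Real.log (2 + M) := by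
            gcongr
            norm_num

end Complexity

end

theorem theorem1 :
    ∃ C : ℝ, 0 < C ∧
    ∀ (d d' : ℕ) (f : Vec d → Vec d' → ℝ) (gx : Vec d → Vec d' → Vec d)
      (gy : Vec d → Vec d' → Vec d') (Y : Set (Vec d')) (l μy L ρ μ : ℝ) (xstar : Vec d),
    NCSCProblem f gx gy Y l μy L ρ μ xstar →
    -- the stochastic gradients and the samples
    ∀ (Ξ : Type*) [MeasurableSpace Ξ] (D : Measure Ξ) [IsProbabilityMeasure D]
      (Gx : Vec d → Vec d' → Ξ → Vec d) (Gy : Vec d → Vec d' → Ξ → Vec d') (σ : ℝ),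
    StochasticGradient D gx gy Y Gx Gy σ →
    ∀ (Ω : Type*) [MeasurableSpace Ω] (Pr : Measure Ω) [IsProbabilityMeasure Pr]
      (ξ : ℕ → ℕ → Ω → Ξ),
    (∀ k t, Measurable (ξ k t)) → (∀ k t, Pr.map (ξ k t) = D) →
    iIndepFun (fun p : ℕ × ℕ => ξ p.1 p.2) Pr →
    -- the initial point, whose duality gap on `f` is finite and at most `ε₀`
    ∀ (x₀ : Vec d) (y₀ : Vec d') (ε₀ : ℝ), y₀ ∈ Y →
    BddBelow (Set.range fun x => f x y₀) → dualityGap f Y x₀ y₀ ≤ ε₀ →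
    ∀ ε : ℝ, 0 < ε →
    -- the maxima and minima in `P` and in the duality gaps are attained
    ((∀ x, ∃ y ∈ Y, IsMaxOn (fun y' => f x y') Y y) ∧
      (∀ w, ∀ y ∈ Y, ∃ x, IsMinOn (fun x' => proxObj f (2 * ρ) w x' y) Set.univ x)) ∧
    -- convergence of the Lyapunov function
    (∀ η₀ : ℝ, 0 < η₀ → η₀ ≤ 1 / (2 * √2 * (l + 2 * ρ)) →
      ∀ K : ℕ, EnoughStages L ρ μ η₀ σ ε₀ ε K →
        Integrable (fun ω => lyapunov f Y L ρ xstar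
          (pes Y Gx Gy (2 * ρ) (stepSize L ρ μ η₀) (epochLength L ρ μ μy η₀)
            (fun k t => ξ k t ω) (x₀, y₀) K)) Pr ∧
        ∫ ω, lyapunov f Y L ρ xstar
          (pes Y Gx Gy (2 * ρ) (stepSize L ρ μ η₀) (epochLength L ρ μ μy η₀)
            (fun k t => ξ k t ω) (x₀, y₀) K) ∂Pr ≤ ε) ∧
    -- total iteration complexity, for the largest admissible `η₀` and the least `K`
    (∀ η₀ : ℝ, η₀ = 1 / (2 * √2 * (l + 2 * ρ)) →
      ∃ K : ℕ, IsLeast {K' : ℕ | EnoughStages L ρ μ η₀ σ ε₀ ε K'} K ∧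
        ((∑ k ∈ Finset.Icc 1 K, epochLength L ρ μ μy η₀ k : ℕ) : ℝ) ≤
          C * complexityBound l μy L ρ μ σ ε₀ ε *
            Real.log (2 + complexityBound l μy L ρ μ σ ε₀ ε)) := by
  refine ⟨40000000, by norm_num, ?_⟩
  intro d d' f gx gy Y l μy L ρ μ xstar hp Ξ _ D _ Gx Gy σ hs Ω _ Pr _ ξ hξ hξD hind x₀ y₀ ε₀ hy₀
    hbdd hgap ε hε
  refine ⟨⟨hp.exists_isMaxOn ⟨y₀, hy₀⟩, fun w y hy => hp.exists_isMinOn w hy⟩, ?_, ?_⟩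
  · intro η₀ hη₀ hη₀l K hK
    obtain ⟨-, -, -, hint, hle⟩ := integral_lyapunov_pes_le hp hs hξ hξD hind hη₀ hη₀l
      (z₀ := (x₀, y₀)) hy₀ rfl K
    refine ⟨hint, hle.trans (exp_mul_le_of_enoughStages hp hε ?_ hK)⟩
    exact (hp.lyapunov_le (z := (x₀, y₀)) hy₀ hbdd).trans (by gcongr)
  · intro η₀ hη₀
    have hε₀ : 0 ≤ ε₀ := ((hp.dualityGap_nonneg x₀ x₀ hy₀).trans
      (hp.dualityGap_proxObj_le x₀ hy₀ hbdd)).trans hgap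
    have hη₀0 : 0 < η₀ := by
      have := hp.ρ_pos
      have := hp.ρ_le
      rw [hη₀]
      have : 0 < l + 2 * ρ := by linarith
      positivity
    obtain ⟨K, hK⟩ := exists_isLeast_enoughStages hp (σ := σ) (ε₀ := ε₀) hη₀0 hε
    exact ⟨K, hK, sum_epochLength_le_complexityBound hp hη₀ hs.σ_pos hε₀ hε hK⟩
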